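/- Let $d\ge 1$. A foliation $\mathcal F$ of degree $d$ on $\mathbb P^2_{\mathbb C}$ is the class, up to a nonzero constant factor, of a $1$-form $\omega=a\,dx+b\,dy+c\,dz$ on $\mathbb C^3$ whose coefficients are homogeneous polynomials of degree $d+1$ without common factor with $xa+yb+zc=0$; $\operatorname{Sing}\mathcal F$ is the set of common zeros of $a,b,c$ in $\mathbb P^2_{\mathbb C}$. The set $\mathbf F(d)$ of these foliations is an open subset of a complex projective space, on which $\mathrm{Aut}(\mathbb P^2_{\mathbb C})=\mathrm{PGL}_3(\mathbb C)$ acts by pull-back of $1$-forms; $\mathcal O(\mathcal F)$ denotes the orbit of $\mathcal F$ and $\overline{\mathcal O(\mathcal F)}$ its closure in $\mathbf F(d)$. Write $\omega=i_{\mathrm R}i_{\mathrm Z}(dx\wedge dy\wedge dz)$, where $\mathrm R$ is the radial vector field and $\mathrm Z$ is a homogeneous vector field of degree $d$ on $\mathbb C^3$. The foliation is convex if its inflection divisor $\det(\mathrm R,\mathrm Z,\mathrm Z(\mathrm Z))=0$ is a product of invariant lines; it is reduced convex if it has $3d$ distinct invariant lines (the largest possible number); it is homogeneous if in some affine chart $(x,y)$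 it is invariant under all homotheties $(x,y)\mapsto\lambda(x,y)$, $\lambda\in\mathbb C^*$. For $s\in\operatorname{Sing}\mathcal F$ let $\mathrm X=A\,\partial_u+B\,\partial_v$ be a vector field defining $\mathcal F$ in affine coordinates $(u,v)$ centered at $s$, and let $\nu$ be the minimum of the vanishing orders of $A$ and $B$ at $s$. The tangency order with a generic line through $s$ is $\tau(\mathcal F,s)=\min\{k\ge\nu : \det(J^k_s\mathrm X,\,u\,\partial_u+v\,\partial_v)\ne0\}$, and the Milnor number is $\mu(\mathcal F,s)=\dim_{\mathbb C}\mathcal O_s/\langle A,B\rangle$, where $\mathcal O_s$ is the local ring at $s$. If $\mu(\mathcal F,s)=1$ and $\ell\ni s$ is an invariant line, the Camacho–Sad index $\mathrm{CS}(\mathcal F,\ell,s)$ is the quotient of the eigenvalue of the linear part $J^1_s\mathrm X$ transverse to $\ell$ (i.e. on $T_s\mathbb P^2_{\mathbb C}/T_s\ell$) by its eigenvalue on $T_s\ell$. Proposition. Let $\mathcal F$ be a reduced convex foliation of degree $d\ge1$ on $\mathbb P^2_{\mathbb C}$ and let $\ell$ be one of its $3d$ invariant lines. Then there is a convex homogeneous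 foliation $\mathcal H$ of degree $d$ on $\mathbb P^2_{\mathbb C}$ such that: (i) $\mathcal H\in\overline{\mathcal O(\mathcal F)}$; (ii) $\ell$ is invariant by $\mathcal H$; (iii) $\operatorname{Sing}\mathcal H\cap\ell=\operatorname{Sing}\mathcal F\cap\ell$; (iv) $\mu(\mathcal H,s)=1$ for all $s\in\operatorname{Sing}\mathcal H\cap\ell$; (v) $\tau(\mathcal H,s)=\tau(\mathcal F,s)$ for all $s\in\operatorname{Sing}\mathcal H\cap\ell$; (vi) for all $s\in\operatorname{Sing}\mathcal H\cap\ell$, one has $\mu(\mathcal F,s)=1$ (so that the index of $\mathcal F$ at $s$ is defined) and $\mathrm{CS}(\mathcal H,\ell,s)=\mathrm{CS}(\mathcal F,\ell,s)$. -/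

import Mathlib

open scoped LinearAlgebra.Projectivization Matrix

noncomputable section

/-- The complex projective plane, with homogeneous coordinates indexed by `Fin 3`. -/
abbrev Plane : Type := ℙ ℂ (Fin 3 → ℂ)

/-- Lines of the projective plane, as points of the dual plane: the class of `(l₀, l₁, l₂)` is the
line with equation `l₀ x + l₁ y + l₂ z = 0`. -/
abbrev Line : Type := ℙ ℂ (Fin 3 → ℂ)

/-- The set of points of a line. -/
def Line.points (ℓ : Line) : Set Plane := {s | Projectivization.orthogonal ℓ s}

/-- The linear form (well defined up to a nonzero factor) defining a line. -/
def Line.form (ℓ : Line) : MvPolynomial (Fin 3) ℂ :=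
  ∑ i, MvPolynomial.C (ℓ.rep i) * MvPolynomial.X i

/-- A polynomial `1`-form `a dx + b dy + c dz` on `ℂ³` defining a foliation of degree `d` of the
plane: `a`, `b`, `c` are homogeneous of degree `d + 1`, without common factor, and satisfy the Euler
condition `x a + y b + z c = 0`. -/
structure FoliationForm (d : ℕ) where
  coeff : Fin 3 → MvPolynomial (Fin 3) ℂ
  isHomogeneous : ∀ i, (coeff i).IsHomogeneous (d + 1)
  noCommonFactor : ∀ p : MvPolynomial (Fin 3) ℂ, (∀ i, p ∣ coeff i) → IsUnit p
  euler : ∑ i, MvPolynomial.X i * coeff i = 0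

/-- Two `1`-forms define the same foliation when they differ by a nonzero constant. -/
instance FoliationForm.setoid (d : ℕ) : Setoid (FoliationForm d) where
  r ω η := ∃ c : ℂ, c ≠ 0 ∧ ∀ i, η.coeff i = MvPolynomial.C c * ω.coeff i
  iseqv :=
    { refl := fun ω => ⟨1, one_ne_zero, fun i => by simp⟩
      symm := by
        rintro ω η ⟨c, hc, h⟩
        refine ⟨c⁻¹, inv_ne_zero hc, fun i => ?_⟩
        rw [h i, ← mul_assoc, ← MvPolynomial.C_mul, inv_mul_cancel₀ hc, MvPolynomial.C_1, one_mul]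
      trans := by
        rintro ω η θ ⟨c, hc, h⟩ ⟨c', hc', h'⟩
        refine ⟨c' * c, mul_ne_zero hc' hc, fun i => ?_⟩
        rw [h' i, h i, ← mul_assoc, ← MvPolynomial.C_mul] }

/-- The topology of the coefficients (for forms of degree `d` only finitely many of them, those of
the monomials of degree `d + 1`, can be nonzero). -/
instance FoliationForm.topologicalSpace (d : ℕ) : TopologicalSpace (FoliationForm d) :=
  TopologicalSpace.induced
    (fun (ω : FoliationForm d) (i : Fin 3) (m : Fin 3 →₀ ℕ) => MvPolynomial.coeff m (ω.coeff i))
    inferInstance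

/-- The space of foliations of degree `d` of the complex projective plane. -/
def Foliation (d : ℕ) : Type := Quotient (FoliationForm.setoid d)

/-- The classical topology, as an open subset of a complex projective space, i.e. the quotient
topology. The closure of an orbit in it is contained in (in fact equal to) its Zariski closure. -/
instance Foliation.topologicalSpace (d : ℕ) : TopologicalSpace (Foliation d) :=
  inferInstanceAs (TopologicalSpace (Quotient (FoliationForm.setoid d)))

/-- The pull-back `g^* ω` of the `1`-form `ω = ∑ ωᵢ dxᵢ` by the linear map `x ↦ g x`. -/
def pullbackForm (g : Matrix (Fin 3) (Fin 3) ℂ) (ω : Fin 3 → MvPolynomial (Fin 3) ℂ) :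
    Fin 3 → MvPolynomial (Fin 3) ℂ := fun j =>
  ∑ i, MvPolynomial.C (g i j) *
    MvPolynomial.aeval (fun k => ∑ l, MvPolynomial.C (g k l) * MvPolynomial.X l) (ω i)

namespace Foliation

variable {d : ℕ}

/-- `1`-forms defining a given foliation. -/
def IsDefinedBy (F : Foliation d) (ω : FoliationForm d) : Prop :=
  F = Quotient.mk (FoliationForm.setoid d) ω

/-- `G = g^* F`, where `g` acts on the plane as an element of `PGL₃(ℂ)`. -/
def IsPullback (g : GL (Fin 3) ℂ) (F G : Foliation d) : Prop :=
  ∃ ω η : FoliationForm d, F.IsDefinedBy ω ∧ G.IsDefinedBy η ∧ η.coeff = pullbackForm g.val ω.coeff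

/-- The orbit of a foliation under the action of `Aut(ℙ²) = PGL₃(ℂ)`. -/
def orbit (F : Foliation d) : Set (Foliation d) := {G | ∃ g : GL (Fin 3) ℂ, IsPullback g F G}

/-- A `1`-form defining the foliation. -/
def form (F : Foliation d) : FoliationForm d := Quotient.out F

/-- The singular locus. -/
def sing (F : Foliation d) : Set Plane :=
  {s | ∀ i, MvPolynomial.eval s.rep (F.form.coeff i) = 0}

/-- A line is invariant when, at each nonzero point of the plane of `ℂ³` over it, this plane is
contained in the kernel of the `1`-form defining the foliation. -/
def IsInvariantLine (F : Foliation d) (ℓ : Line) : Prop :=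
  ∀ p v : Fin 3 → ℂ, ℓ.rep ⬝ᵥ p = 0 → ℓ.rep ⬝ᵥ v = 0 →
    ∑ i, MvPolynomial.eval p (F.form.coeff i) * v i = 0

/-- A foliation of degree `d ≥ 1` is reduced convex when it has `3 d` distinct invariant lines,
which is the largest possible number. -/
def IsReducedConvex (F : Foliation d) : Prop := {ℓ | F.IsInvariantLine ℓ}.ncard = 3 * d

/-- A homogeneous vector field `Z = Z₀ ∂/∂x + Z₁ ∂/∂y + Z₂ ∂/∂z` of degree `d` on `ℂ³` describes the
foliation when `ω = i_R i_Z (dx ∧ dy ∧ dz)`, whose coefficients are those of the cross product of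
`Z` and the radial field `R`. -/
def IsDescribedBy (F : Foliation d) (Z : Fin 3 → MvPolynomial (Fin 3) ℂ) : Prop :=
  (∀ i, (Z i).IsHomogeneous d) ∧ F.form.coeff = crossProduct Z MvPolynomial.X

end Foliation

/-- The derivative `Z(f)` of a polynomial along a vector field. -/
def lieDerivative (Z : Fin 3 → MvPolynomial (Fin 3) ℂ) (f : MvPolynomial (Fin 3) ℂ) :
    MvPolynomial (Fin 3) ℂ := ∑ i, Z i * MvPolynomial.pderiv i f

/-- The equation of the inflection divisor: the determinant with columns `R`, `Z`, `Z(Z)`. -/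
def inflectionPolynomial (Z : Fin 3 → MvPolynomial (Fin 3) ℂ) : MvPolynomial (Fin 3) ℂ :=
  Matrix.det (Matrix.of fun i => ![MvPolynomial.X i, Z i, lieDerivative Z (Z i)])

/-- The homothety `(x, y) ↦ t (x, y)` of the affine chart `z = 1`. -/
def homothety (t : ℂˣ) : GL (Fin 3) ℂ :=
  Matrix.GeneralLinearGroup.mk'' (Matrix.diagonal ![(t : ℂ), (t : ℂ), 1])
    (by simp [Matrix.det_diagonal, Fin.prod_univ_three])

/-- `g` provides affine coordinates `(u, v) ↦ [g (u, v, 1)]` centered at `s`. -/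
def IsFrameAt (s : Plane) (g : GL (Fin 3) ℂ) : Prop := g.val *ᵥ ![0, 0, 1] = s.rep

/-- `g` provides affine coordinates `(u, v) ↦ [g (u, v, 1)]` centered at the point `s` of `ℓ`, in
which `ℓ` is the line `v = 0`. -/
def IsAdaptedFrame (ℓ : Line) (s : Plane) (g : GL (Fin 3) ℂ) : Prop :=
  IsFrameAt s g ∧ ℓ.rep ⬝ᵥ (g.val *ᵥ ![1, 0, 0]) = 0

/-- Some affine coordinates centered at `s`. -/
def frameAt (s : Plane) : GL (Fin 3) ℂ := Classical.epsilon (IsFrameAt s)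

/-- Some affine coordinates centered at `s ∈ ℓ`, in which `ℓ` is the line `v = 0`. -/
def adaptedFrame (ℓ : Line) (s : Plane) : GL (Fin 3) ℂ := Classical.epsilon (IsAdaptedFrame ℓ s)

theorem exists_isAdaptedFrame (ℓ : Line) (s : Plane) (h : s ∈ ℓ.points) :
    ∃ g, IsAdaptedFrame ℓ s g := by
  have hl : ℓ.rep ≠ 0 := ℓ.rep_nonzero
  have hp : s.rep ≠ 0 := s.rep_nonzero
  have hlp : ℓ.rep ⬝ᵥ s.rep = 0 := by
    have h' : Projectivization.orthogonal ℓ s := h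
    rw [← ℓ.mk_rep, ← s.mk_rep] at h'
    exact (Projectivization.orthogonal_mk hl hp).1 h'
  generalize hL : ℓ.rep = l at *
  generalize hP : s.rep = p at *
  let q : Fin 3 → ℂ := crossProduct l (star p)
  let M : Matrix (Fin 3) (Fin 3) ℂ := Matrix.of fun i => ![q i, star (l i), p i]
  have hdet : M.det = (star l ⬝ᵥ l) * (star p ⬝ᵥ p) - (l ⬝ᵥ p) * star (l ⬝ᵥ p) := by
    simp [M, q, Matrix.det_fin_three, cross_apply, dotProduct, Fin.sum_univ_three]
    ring
  have hdet0 : IsUnit M.det := by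
    rw [hdet, hlp, zero_mul, sub_zero, isUnit_iff_ne_zero]
    open scoped ComplexOrder in
    exact mul_ne_zero (mt dotProduct_star_self_eq_zero.1 hl)
      (mt dotProduct_star_self_eq_zero.1 hp)
  refine ⟨Matrix.GeneralLinearGroup.mk'' M hdet0, ?_, ?_⟩
  · change M *ᵥ ![0, 0, 1] = s.rep
    rw [hP]
    ext i
    simp [M, Matrix.mulVec, dotProduct, Fin.sum_univ_three]
  · change ℓ.rep ⬝ᵥ (M *ᵥ ![1, 0, 0]) = 0
    rw [hL]
    simp [M, q, Matrix.mulVec, dotProduct, Fin.sum_univ_three, cross_apply]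
    ring

theorem exists_isFrameAt (s : Plane) : ∃ g, IsFrameAt s g := by
  obtain ⟨l, hl, h⟩ := (Matrix.exists_mulVec_eq_zero_iff (M := Matrix.of ![s.rep, 0, 0])).2
    (Matrix.det_eq_zero_of_row_eq_zero 1 fun _ => rfl)
  have h0 : s.rep ⬝ᵥ l = 0 := congrFun h 0
  have hmem : s ∈ Line.points (Projectivization.mk ℂ l hl) := by
    have h1 := (Projectivization.orthogonal_mk hl s.rep_nonzero).2 (dotProduct_comm l s.rep ▸ h0)
    rwa [s.mk_rep] at h1
  obtain ⟨g, hg, -⟩ := exists_isAdaptedFrame _ s hmem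
  exact ⟨g, hg⟩

instance : (RingHom.ker
    (MvPolynomial.constantCoeff : MvPolynomial (Fin 2) ℂ →+* ℂ)).IsPrime :=
  RingHom.ker_isPrime _

/-- The local ring of the plane at the origin of an affine chart with coordinates `(u, v)`: the
localization of `ℂ[u, v]` at the ideal of the polynomials vanishing at the origin. -/
abbrev LocalRing : Type :=
  Localization.AtPrime
    (RingHom.ker (MvPolynomial.constantCoeff : MvPolynomial (Fin 2) ℂ →+* ℂ))

/-- The vanishing order of a polynomial at the origin (`⊤` for the zero polynomial). -/
def vanishingOrder (p : MvPolynomial (Fin 2) ℂ) : ℕ∞ :=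
  (p : MvPowerSeries (Fin 2) ℂ).order

/-- The `k`-jet at the origin of a polynomial. -/
def jet (k : ℕ) (p : MvPolynomial (Fin 2) ℂ) : MvPolynomial (Fin 2) ℂ :=
  ∑ i ∈ Finset.range (k + 1), MvPolynomial.homogeneousComponent i p

namespace Foliation

variable {d : ℕ}

/-- A foliation is convex when its inflection divisor is a product of invariant lines. -/
def IsConvex (F : Foliation d) : Prop :=
  ∃ Z, F.IsDescribedBy Z ∧ ∃ (c : ℂ) (m : Multiset Line), c ≠ 0 ∧ (∀ ℓ ∈ m, F.IsInvariantLine ℓ) ∧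
    inflectionPolynomial Z = MvPolynomial.C c * (m.map Line.form).prod

/-- A foliation is homogeneous when there is an affine chart in which it is invariant under all
homotheties `(x, y) ↦ t (x, y)`. -/
def IsHomogeneous (F : Foliation d) : Prop :=
  ∃ (g : GL (Fin 3) ℂ) (G : Foliation d), IsPullback g F G ∧
    ∀ t : ℂˣ, IsPullback (homothety t) G G

/-- The coefficients `(P, Q)` of the `1`-form `P du + Q dv` defining the foliation in the affine
coordinates `(u, v) ↦ [g (u, v, 1)]`. -/
def localForm (F : Foliation d) (g : GL (Fin 3) ℂ) : Fin 2 → MvPolynomial (Fin 2) ℂ := fun j =>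
  MvPolynomial.aeval ![MvPolynomial.X 0, MvPolynomial.X 1, 1]
    (pullbackForm g.val F.form.coeff j.castSucc)

/-- The components `(A, B) = (Q, -P)` of the vector field `A ∂/∂u + B ∂/∂v` defining the foliation
in the affine coordinates `(u, v) ↦ [g (u, v, 1)]`. -/
def localField (F : Foliation d) (g : GL (Fin 3) ℂ) : Fin 2 → MvPolynomial (Fin 2) ℂ :=
  ![F.localForm g 1, -F.localForm g 0]

/-- The vanishing order `ν(F, s)`. -/
def nu (F : Foliation d) (s : Plane) : ℕ∞ :=
  min (vanishingOrder (F.localField (frameAt s) 0)) (vanishingOrder (F.localField (frameAt s) 1))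

/-- The tangency order `τ(F, s)` with a generic line through `s`: the least `k ≥ ν(F, s)` with
`det (J^k X, R) ≠ 0`, where `X` is a vector field defining `F` near `s` and `R` is the radial vector
field centered at `s`. -/
def tau (F : Foliation d) (s : Plane) : ℕ :=
  sInf {k : ℕ | F.nu s ≤ k ∧
    Matrix.det !![jet k (F.localField (frameAt s) 0), MvPolynomial.X 0;
                  jet k (F.localField (frameAt s) 1), MvPolynomial.X 1] ≠ 0}

/-- The Milnor number `μ(F, s)`, the dimension of `𝒪_s / ⟨A, B⟩`. -/
def milnor (F : Foliation d) (s : Plane) : ℕ∞ :=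
  Cardinal.toENat (Module.rank ℂ (LocalRing ⧸ Ideal.span
    (Set.range fun i => algebraMap (MvPolynomial (Fin 2) ℂ) LocalRing
      (F.localField (frameAt s) i))))

/-- The matrix of the linear part at the origin of the vector field defining the foliation in the
affine coordinates `(u, v) ↦ [g (u, v, 1)]`. -/
def linearPart (F : Foliation d) (g : GL (Fin 3) ℂ) : Matrix (Fin 2) (Fin 2) ℂ :=
  Matrix.of fun i j => MvPolynomial.coeff (Finsupp.single j 1) (F.localField g i)

/-- The Camacho-Sad index `CS(F, ℓ, s)` of a foliation along an invariant line `ℓ` at a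
non-degenerate singularity `s ∈ ℓ`. In affine coordinates centered at `s` in which `ℓ` is `v = 0`,
the linear part is upper triangular; the index is the quotient of the eigenvalue transverse to `ℓ`
(the second diagonal entry) by the eigenvalue tangent to `ℓ` (the first one). -/
def camachoSad (F : Foliation d) (ℓ : Line) (s : Plane) : ℂ :=
  F.linearPart (adaptedFrame ℓ s) 1 1 / F.linearPart (adaptedFrame ℓ s) 0 0

end Foliation

end

/-!
Write the line `ℓ` as `l = 0`, choose a vector `o` with `l(o) = 1` and let `π(x) = x - l(x) o` be the
projection of `ℂ³` onto the plane `l = 0`. As `ℓ` is invariant, a form defining `F` is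
`ω = l(R) θ - θ(R) l`, with `θ(o) = 0` (`FoliationForm.exists_eq_lineForm`). The foliation `H` is
defined by the form obtained on replacing `θ` by `θ ∘ π`. In an affine chart with `ℓ` at infinity and
`o` as origin this is the homogeneous part of highest degree of the affine `1`-form, hence the limit
of its images under dilations (`Foliation.mem_closure_orbit_of_lineForm_projHom`), and it is
invariant under homotheties (`pullbackForm_homothety`).

The main point is that at a singular point `s` of `F`, the Milnor number is `1` and `τ(F, s) + 1` is
the number `r` of invariant lines through `s`. The inflection divisor is not identically zero
(`inflectionPolynomial_ne_zero`), it has degree `3 d` and contains all invariant lines, so it is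
their sum (`inflectionPolynomial_eq_prod`), and its vanishing order at `s` is `r`. If the field
`X = A ∂u + B ∂v` defines `F` near `s` and `D = A v - B u`, then the inflection divisor
`I = A X(B) - B X(A)` satisfies `u I = D X(A) - A X(D)`. On comparing vanishing orders,
`1 + r ≥ ord D + 2 ν - 1`; but `r ≤ ord D`, since the `r` invariant lines divide `D`. Therefore
`ν = 1` and `ord D = r`, and a similar comparison shows that the linear part of `X` is invertible
(`vanishingOrder_contact_and_nondegenerate`).

It follows that `θ` has no zero on `ℓ`, so that the form defining `H` has coprime coefficients
(`isUnit_of_dvd_lineForm_projHom`). With the vector field `Z = l × θ`, the inflection divisor of `F`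
is `l * q` and that of `H` is `l * (q ∘ π)`, where `q` is the product of the other invariant lines;
these lines composed with `π` are invariant by `H`, which is thus convex. Along `ℓ` the two forms
coincide, and their derivatives differ by a multiple of `l ⊗ l` (`exists_jacobian_lineForm_projHom`):
this gives the singularities, the Milnor numbers and the Camacho-Sad indices. Finally the polar
`D` of `F` at `s ∈ ℓ` is the product of `l`, of `r - 1` lines and of a factor not vanishing at `s`,
and composing all factors but `l` with `π` gives that of `H`, whose vanishing order is again `r`
(`vanishingOrder_polar_projHom`).
-/

open MvPolynomial

/-! ### Linear forms and restriction to a line -/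

theorem eval_aeval {σ τ : Type*} (P : σ → MvPolynomial τ ℂ) (x : τ → ℂ) (f : MvPolynomial σ ℂ) :
    eval x (aeval P f) = eval (fun k => eval x (P k)) f := by
  induction f using MvPolynomial.induction_on with
  | C a => simp
  | add p q hp hq => rw [map_add, map_add, map_add, hp, hq]
  | mul_X p i hp => rw [map_mul, map_mul, map_mul, hp, aeval_X, eval_X]

/-- The linear form `x ↦ l ⬝ᵥ x`, as a polynomial. -/
noncomputable def linForm (l : Fin 3 → ℂ) : MvPolynomial (Fin 3) ℂ := ∑ i, C (l i) * X i

/-- Precomposition of polynomials with the linear map `x ↦ x - (l ⬝ᵥ x) • o`; when `l ⬝ᵥ o = 1`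
this map is the projection onto the plane `l ⬝ᵥ x = 0` along the vector `o`. -/
noncomputable def projHom (l o : Fin 3 → ℂ) :
    MvPolynomial (Fin 3) ℂ →ₐ[ℂ] MvPolynomial (Fin 3) ℂ :=
  aeval fun k => X k - C (o k) * linForm l

@[simp] theorem eval_linForm (l x : Fin 3 → ℂ) : eval x (linForm l) = l ⬝ᵥ x := by
  simp [linForm, dotProduct]

theorem linForm_isHomogeneous (l : Fin 3 → ℂ) : (linForm l).IsHomogeneous 1 :=
  IsHomogeneous.sum _ _ _ fun _ _ => isHomogeneous_C_mul_X _ _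

theorem linForm_injective : Function.Injective linForm := by
  intro l m h
  ext i
  simpa using congrArg (eval (Pi.single i 1)) h

theorem linForm_ne_zero {l : Fin 3 → ℂ} (h : l ≠ 0) : linForm l ≠ 0 := by
  intro h'
  exact h (linForm_injective (by rw [h']; simp [linForm]))

theorem linForm_smul (c : ℂ) (l : Fin 3 → ℂ) : linForm (c • l) = C c * linForm l := by
  simp [linForm, Finset.mul_sum, mul_assoc]

theorem pderiv_linForm (l : Fin 3 → ℂ) (i : Fin 3) : pderiv i (linForm l) = C (l i) := by
  simp [linForm, pderiv_X, Pi.single_apply]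

theorem eval_projHom (l o x : Fin 3 → ℂ) (f : MvPolynomial (Fin 3) ℂ) :
    eval x (projHom l o f) = eval (x - (l ⬝ᵥ x) • o) f := by
  rw [projHom, eval_aeval]
  have : (fun k => eval x (X k - C (o k) * linForm l)) = x - (l ⬝ᵥ x) • o := by
    ext k
    simp [mul_comm]
  rw [this]

theorem projHom_linForm (l o m : Fin 3 → ℂ) :
    projHom l o (linForm m) = linForm (m - (m ⬝ᵥ o) • l) := by
  refine MvPolynomial.funext fun x => ?_
  simp [eval_projHom, sub_dotProduct, dotProduct_sub, mul_comm]

theorem projHom_linForm_self {l o : Fin 3 → ℂ} (h : l ⬝ᵥ o = 1) :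
    projHom l o (linForm l) = 0 := by
  rw [projHom_linForm, h, one_smul, sub_self]
  simp [linForm]

theorem linForm_dvd_sub_projHom (l o : Fin 3 → ℂ) (f : MvPolynomial (Fin 3) ℂ) :
    linForm l ∣ f - projHom l o f := by
  induction f using MvPolynomial.induction_on with
  | C a => simp [projHom]
  | add p q hp hq =>
    rw [map_add, add_sub_add_comm]
    exact dvd_add hp hq
  | mul_X p i hp =>
    have : p * X i - projHom l o (p * X i) =
        (p - projHom l o p) * X i + projHom l o p * (C (o i) * linForm l) := by
      rw [map_mul]
      simp only [projHom, aeval_X]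
      ring
    rw [this]
    exact dvd_add (Dvd.dvd.mul_right hp _) (Dvd.dvd.mul_left (Dvd.dvd.mul_left dvd_rfl _) _)

theorem linForm_dvd_iff_projHom_eq_zero {l o : Fin 3 → ℂ} (h : l ⬝ᵥ o = 1)
    (f : MvPolynomial (Fin 3) ℂ) : linForm l ∣ f ↔ projHom l o f = 0 := by
  constructor
  · rintro ⟨g, rfl⟩
    rw [map_mul, projHom_linForm_self h, zero_mul]
  · intro h0
    simpa [h0] using linForm_dvd_sub_projHom l o f

theorem exists_dotProduct_eq_one {l : Fin 3 → ℂ} (h : l ≠ 0) : ∃ o, l ⬝ᵥ o = 1 := by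
  obtain ⟨i, hi⟩ := Function.ne_iff.1 h
  exact ⟨Pi.single i (l i)⁻¹, by simp [mul_inv_cancel₀ hi]⟩

/-- A nonzero linear form `l` is prime, since the ideal it generates is the kernel of the
restriction of polynomials to the plane `l = 0`. -/
theorem prime_linForm {l : Fin 3 → ℂ} (h : l ≠ 0) : Prime (linForm l) := by
  obtain ⟨o, ho⟩ := exists_dotProduct_eq_one h
  refine ⟨linForm_ne_zero h, fun hu => ?_, fun a b hab => ?_⟩
  · have := (linForm_dvd_iff_projHom_eq_zero ho 1).1 hu.dvd
    simp at this
  · simp only [linForm_dvd_iff_projHom_eq_zero ho, map_mul, mul_eq_zero] at *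
    exact hab

theorem exists_smul_of_linForm_dvd {l m : Fin 3 → ℂ} (hl : l ≠ 0)
    (h : linForm l ∣ linForm m) : ∃ c : ℂ, m = c • l := by
  obtain ⟨o, ho⟩ := exists_dotProduct_eq_one hl
  rw [linForm_dvd_iff_projHom_eq_zero ho, projHom_linForm] at h
  refine ⟨m ⬝ᵥ o, sub_eq_zero.1 (linForm_injective ?_)⟩
  rw [h]; simp [linForm]

theorem linForm_dvd_of_eval_eq_zero {l : Fin 3 → ℂ} (hl : l ≠ 0) {f : MvPolynomial (Fin 3) ℂ}
    (h : ∀ x, l ⬝ᵥ x = 0 → eval x f = 0) : linForm l ∣ f := by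
  obtain ⟨o, ho⟩ := exists_dotProduct_eq_one hl
  rw [linForm_dvd_iff_projHom_eq_zero ho]
  refine MvPolynomial.funext fun x => ?_
  rw [eval_projHom, map_zero]
  exact h _ (by simp [dotProduct_sub, ho])

theorem projHom_projHom {l o : Fin 3 → ℂ} (h : l ⬝ᵥ o = 1) (f : MvPolynomial (Fin 3) ℂ) :
    projHom l o (projHom l o f) = projHom l o f := by
  refine MvPolynomial.funext fun x => ?_
  simp [eval_projHom, dotProduct_sub, h]

theorem projHom_isHomogeneous (l o : Fin 3 → ℂ) {f : MvPolynomial (Fin 3) ℂ} {n : ℕ}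
    (h : f.IsHomogeneous n) : (projHom l o f).IsHomogeneous n := by
  have := h.aeval (fun k => X k - C (o k) * linForm l) (n := 1) fun k =>
    (isHomogeneous_X _ _).sub ((linForm_isHomogeneous l).C_mul _)
  rwa [one_mul] at this

/-- If `f` divides all products `ω i * g` and the `ω i` have no common factor, `f` divides `g`. -/
theorem dvd_of_forall_dvd_mul {ω : Fin 3 → MvPolynomial (Fin 3) ℂ}
    (hω : ∀ p : MvPolynomial (Fin 3) ℂ, (∀ i, p ∣ ω i) → IsUnit p)
    {f g : MvPolynomial (Fin 3) ℂ} (h : ∀ i, f ∣ ω i * g) : f ∣ g := by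
  classical
  let _ : GCDMonoid (MvPolynomial (Fin 3) ℂ) := UniqueFactorizationMonoid.toGCDMonoid _
  have hu : IsUnit (gcd (ω 0) (gcd (ω 1) (ω 2))) := hω _ fun i => by
    fin_cases i
    · exact gcd_dvd_left _ _
    · exact (gcd_dvd_right _ _).trans (gcd_dvd_left _ _)
    · exact (gcd_dvd_right _ _).trans (gcd_dvd_right _ _)
  have h1 : f ∣ gcd (ω 1) (ω 2) * g :=
    (dvd_gcd (h 1) (h 2)).trans (gcd_mul_right' g _ _).dvd
  have h2 : f ∣ gcd (ω 0) (gcd (ω 1) (ω 2)) * g :=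
    (dvd_gcd (h 0) h1).trans (gcd_mul_right' g _ _).dvd
  rwa [hu.dvd_mul_left] at h2

/-! ### Linear changes of coordinates -/

/-- The value `ω(x)·v` of a polynomial `1`-form, as a bilinear pairing. -/
noncomputable def evalForm (ω : Fin 3 → MvPolynomial (Fin 3) ℂ) (x v : Fin 3 → ℂ) : ℂ :=
  (fun i => eval x (ω i)) ⬝ᵥ v

/-- Precomposition of polynomials with the linear map `x ↦ g *ᵥ x`. -/
noncomputable def matHom (g : Matrix (Fin 3) (Fin 3) ℂ) :
    MvPolynomial (Fin 3) ℂ →ₐ[ℂ] MvPolynomial (Fin 3) ℂ :=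
  aeval fun k => ∑ l, C (g k l) * X l

theorem eval_matHom (g : Matrix (Fin 3) (Fin 3) ℂ) (x : Fin 3 → ℂ) (f : MvPolynomial (Fin 3) ℂ) :
    eval x (matHom g f) = eval (g *ᵥ x) f := by
  rw [matHom, eval_aeval]
  have : (fun k => eval x (∑ l, C (g k l) * X l)) = g *ᵥ x := by
    ext k
    simp [Matrix.mulVec, dotProduct]
  rw [this]

theorem matHom_matHom (g h : Matrix (Fin 3) (Fin 3) ℂ) (f : MvPolynomial (Fin 3) ℂ) :
    matHom h (matHom g f) = matHom (g * h) f :=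
  MvPolynomial.funext fun x => by simp [eval_matHom]

theorem matHom_one (f : MvPolynomial (Fin 3) ℂ) : matHom 1 f = f :=
  MvPolynomial.funext fun x => by simp [eval_matHom]

theorem matHom_linForm (g : Matrix (Fin 3) (Fin 3) ℂ) (l : Fin 3 → ℂ) :
    matHom g (linForm l) = linForm (l ᵥ* g) :=
  MvPolynomial.funext fun x => by simp [eval_matHom, Matrix.dotProduct_mulVec]

theorem matHom_isHomogeneous (g : Matrix (Fin 3) (Fin 3) ℂ) {f : MvPolynomial (Fin 3) ℂ} {n : ℕ}
    (h : f.IsHomogeneous n) : (matHom g f).IsHomogeneous n := by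
  have := h.aeval (fun k => ∑ l, C (g k l) * X l) (n := 1) fun k =>
    IsHomogeneous.sum _ _ _ fun _ _ => isHomogeneous_C_mul_X _ _
  rwa [one_mul] at this

theorem pullbackForm_apply (g : Matrix (Fin 3) (Fin 3) ℂ) (ω : Fin 3 → MvPolynomial (Fin 3) ℂ)
    (j : Fin 3) : pullbackForm g ω j = ∑ i, C (g i j) * matHom g (ω i) := rfl

theorem evalForm_pullbackForm (g : Matrix (Fin 3) (Fin 3) ℂ)
    (ω : Fin 3 → MvPolynomial (Fin 3) ℂ) (x v : Fin 3 → ℂ) :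
    evalForm (pullbackForm g ω) x v = evalForm ω (g *ᵥ x) (g *ᵥ v) := by
  simp [evalForm, pullbackForm_apply, eval_matHom, Matrix.mulVec, dotProduct, Fin.sum_univ_three]
  ring

theorem evalForm_ext {ω η : Fin 3 → MvPolynomial (Fin 3) ℂ}
    (h : ∀ x v, evalForm ω x v = evalForm η x v) : ω = η := by
  ext1 i
  refine MvPolynomial.funext fun x => ?_
  simpa [evalForm] using h x (Pi.single i 1)

theorem pullbackForm_pullbackForm (g h : Matrix (Fin 3) (Fin 3) ℂ)
    (ω : Fin 3 → MvPolynomial (Fin 3) ℂ) :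
    pullbackForm h (pullbackForm g ω) = pullbackForm (g * h) ω :=
  evalForm_ext fun x v => by simp [evalForm_pullbackForm]

theorem pullbackForm_one (ω : Fin 3 → MvPolynomial (Fin 3) ℂ) : pullbackForm 1 ω = ω :=
  evalForm_ext fun x v => by simp [evalForm_pullbackForm]

theorem euler_iff_evalForm (ω : Fin 3 → MvPolynomial (Fin 3) ℂ) :
    ∑ i, X i * ω i = 0 ↔ ∀ x, evalForm ω x x = 0 := by
  constructor
  · intro h x
    simpa [evalForm, dotProduct, mul_comm] using congrArg (eval x) h
  · intro h
    refine MvPolynomial.funext fun x => ?_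
    simpa [evalForm, dotProduct, mul_comm] using h x

/-- The class of forms defining foliations is stable under linear changes of coordinates. -/
noncomputable def FoliationForm.pullback {d : ℕ} (g : GL (Fin 3) ℂ) (ω : FoliationForm d) :
    FoliationForm d where
  coeff := pullbackForm g.val ω.coeff
  isHomogeneous j := IsHomogeneous.sum _ _ _ fun i _ =>
    (matHom_isHomogeneous _ (ω.isHomogeneous i)).C_mul _
  noCommonFactor p hp := by
    have h1 : ∀ i, matHom (g⁻¹).val p ∣ ω.coeff i := fun i => by
      have : ω.coeff i = pullbackForm (g⁻¹).val (pullbackForm g.val ω.coeff) i := by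
        rw [pullbackForm_pullbackForm, ← Units.val_mul, mul_inv_cancel, Units.val_one,
          pullbackForm_one]
      rw [this]
      exact Finset.dvd_sum fun j _ => Dvd.dvd.mul_left (map_dvd _ (hp j)) _
    have h2 := (ω.noCommonFactor _ h1).map (matHom g.val)
    rwa [matHom_matHom, ← Units.val_mul, inv_mul_cancel, Units.val_one, matHom_one] at h2
  euler := by
    rw [euler_iff_evalForm]
    intro x
    rw [evalForm_pullbackForm]
    exact (euler_iff_evalForm _).1 ω.euler _

/-- The product of a form defining a foliation with a nonzero constant. -/
noncomputable def FoliationForm.scale {d : ℕ} (c : ℂ) (hc : c ≠ 0) (ω : FoliationForm d) :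
    FoliationForm d where
  coeff i := C c * ω.coeff i
  isHomogeneous i := (ω.isHomogeneous i).C_mul _
  noCommonFactor p hp := ω.noCommonFactor p fun i =>
    ((isUnit_iff_ne_zero.2 hc).map C).dvd_mul_left.1 (hp i)
  euler := by
    have h : ∀ i, X i * (C c * ω.coeff i) = C c * (X i * ω.coeff i) := fun i => by ring
    simp_rw [h]
    rw [← Finset.mul_sum, ω.euler, mul_zero]

/-- The line `l = 0` is invariant by the foliation defined by the `1`-form `ω`. -/
def FormInvariant (ω : Fin 3 → MvPolynomial (Fin 3) ℂ) (l : Fin 3 → ℂ) : Prop :=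
  ∀ p v : Fin 3 → ℂ, l ⬝ᵥ p = 0 → l ⬝ᵥ v = 0 → evalForm ω p v = 0

theorem Foliation.isInvariantLine_iff {d : ℕ} (F : Foliation d) (ℓ : Line) :
    F.IsInvariantLine ℓ ↔ FormInvariant F.form.coeff ℓ.rep := Iff.rfl

theorem FormInvariant.pullback {ω : Fin 3 → MvPolynomial (Fin 3) ℂ} {l : Fin 3 → ℂ}
    (h : FormInvariant ω l) (g : Matrix (Fin 3) (Fin 3) ℂ) :
    FormInvariant (pullbackForm g ω) (l ᵥ* g) := fun p v hp hv => by
  rw [evalForm_pullbackForm]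
  rw [← Matrix.dotProduct_mulVec] at hp hv
  exact h _ _ hp hv

/-- The foliation defined by a `1`-form. -/
def FoliationForm.toFoliation {d : ℕ} (ω : FoliationForm d) : Foliation d :=
  Quotient.mk (FoliationForm.setoid d) ω

theorem Foliation.toFoliation_form {d : ℕ} (F : Foliation d) : F.form.toFoliation = F :=
  Quotient.out_eq (s := FoliationForm.setoid d) F

/-- A form proportional to a form defining a foliation defines the same foliation. -/
theorem FoliationForm.toFoliation_eq_of_eq_C_mul {d : ℕ} {ω η : FoliationForm d} {c : ℂ}
    (hc : c ≠ 0) (h : η.coeff = fun i => C c * ω.coeff i) : ω.toFoliation = η.toFoliation :=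
  Quotient.sound (s := FoliationForm.setoid d) ⟨c, hc, fun i => congrFun h i⟩

theorem FoliationForm.exists_form_toFoliation_eq {d : ℕ} (ω : FoliationForm d) :
    ∃ c : ℂ, c ≠ 0 ∧ ω.toFoliation.form.coeff = fun i => C c * ω.coeff i := by
  obtain ⟨c, hc, h⟩ := Quotient.exact (s := FoliationForm.setoid d)
    (Foliation.toFoliation_form ω.toFoliation).symm
  exact ⟨c, hc, funext h⟩

/-! ### The inflection divisor and the invariant lines -/

theorem lieDerivative_mul (Z : Fin 3 → MvPolynomial (Fin 3) ℂ) (f g : MvPolynomial (Fin 3) ℂ) :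
    lieDerivative Z (f * g) = lieDerivative Z f * g + f * lieDerivative Z g := by
  simp only [lieDerivative, Fin.sum_univ_three, pderiv_mul]
  ring

theorem lieDerivative_sub (Z : Fin 3 → MvPolynomial (Fin 3) ℂ) (f g : MvPolynomial (Fin 3) ℂ) :
    lieDerivative Z (f - g) = lieDerivative Z f - lieDerivative Z g := by
  simp only [lieDerivative, Fin.sum_univ_three, map_sub]
  ring

@[simp] theorem lieDerivative_X (Z : Fin 3 → MvPolynomial (Fin 3) ℂ) (i : Fin 3) :
    lieDerivative Z (X i) = Z i := by
  simp [lieDerivative, pderiv_X, Pi.single_apply]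

/-- The contraction `l(Z)` of a polynomial vector field with a constant covector, or of a polynomial
`1`-form with a constant vector; in the second case it is the polar of the foliation at the point
defined by the vector. -/
noncomputable def dotForm (l : Fin 3 → ℂ) (Z : Fin 3 → MvPolynomial (Fin 3) ℂ) :
    MvPolynomial (Fin 3) ℂ := ∑ i, C (l i) * Z i

theorem dotForm_X (l : Fin 3 → ℂ) : dotForm l X = linForm l := rfl

theorem eval_dotForm (l x : Fin 3 → ℂ) (Z : Fin 3 → MvPolynomial (Fin 3) ℂ) :
    eval x (dotForm l Z) = l ⬝ᵥ fun i => eval x (Z i) := by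
  simp [dotForm, dotProduct]

theorem dotForm_isHomogeneous (l : Fin 3 → ℂ) {Z : Fin 3 → MvPolynomial (Fin 3) ℂ} {n : ℕ}
    (hZ : ∀ i, (Z i).IsHomogeneous n) : (dotForm l Z).IsHomogeneous n :=
  IsHomogeneous.sum _ _ _ fun i _ => (hZ i).C_mul _

theorem lieDerivative_dotForm (Z W : Fin 3 → MvPolynomial (Fin 3) ℂ) (l : Fin 3 → ℂ) :
    lieDerivative Z (dotForm l W) = dotForm l fun i => lieDerivative Z (W i) := by
  simp only [lieDerivative, dotForm, Fin.sum_univ_three, map_add, pderiv_C_mul]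
  ring

theorem lieDerivative_isHomogeneous {Z : Fin 3 → MvPolynomial (Fin 3) ℂ} {m n : ℕ}
    (hZ : ∀ i, (Z i).IsHomogeneous m) {f : MvPolynomial (Fin 3) ℂ} (hf : f.IsHomogeneous n) :
    (lieDerivative Z f).IsHomogeneous (m + (n - 1)) :=
  IsHomogeneous.sum _ _ _ fun i _ => (hZ i).mul hf.pderiv

theorem inflectionPolynomial_eq (Z : Fin 3 → MvPolynomial (Fin 3) ℂ) :
    inflectionPolynomial Z =
      X 0 * Z 1 * lieDerivative Z (Z 2) - X 0 * lieDerivative Z (Z 1) * Z 2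
      - Z 0 * X 1 * lieDerivative Z (Z 2) + Z 0 * lieDerivative Z (Z 1) * X 2
      + lieDerivative Z (Z 0) * X 1 * Z 2 - lieDerivative Z (Z 0) * Z 1 * X 2 := by
  simp [inflectionPolynomial, Matrix.det_fin_three]

theorem inflectionPolynomial_isHomogeneous {d : ℕ} (hd : 1 ≤ d)
    {Z : Fin 3 → MvPolynomial (Fin 3) ℂ} (hZ : ∀ i, (Z i).IsHomogeneous d) :
    (inflectionPolynomial Z).IsHomogeneous (3 * d) := by
  have hL : ∀ i, (lieDerivative Z (Z i)).IsHomogeneous (d + (d - 1)) := fun i =>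
    lieDerivative_isHomogeneous hZ (hZ i)
  have hX : ∀ i : Fin 3, (X i : MvPolynomial (Fin 3) ℂ).IsHomogeneous 1 := isHomogeneous_X _
  have e1 : 3 * d = 1 + d + (d + (d - 1)) := by omega
  have e2 : 3 * d = 1 + (d + (d - 1)) + d := by omega
  have e3 : 3 * d = d + 1 + (d + (d - 1)) := by omega
  have e4 : 3 * d = d + (d + (d - 1)) + 1 := by omega
  have e5 : 3 * d = d + (d - 1) + 1 + d := by omega
  have e6 : 3 * d = d + (d - 1) + d + 1 := by omega
  rw [inflectionPolynomial_eq]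
  refine IsHomogeneous.sub (.add (.add (.sub (.sub ?_ ?_) ?_) ?_) ?_) ?_
  · rw [e1]; exact ((hX _).mul (hZ _)).mul (hL _)
  · rw [e2]; exact ((hX _).mul (hL _)).mul (hZ _)
  · rw [e3]; exact ((hZ _).mul (hX _)).mul (hL _)
  · rw [e4]; exact ((hZ _).mul (hL _)).mul (hX _)
  · rw [e5]; exact ((hL _).mul (hX _)).mul (hZ _)
  · rw [e6]; exact ((hL _).mul (hZ _)).mul (hX _)

/-- The derivative of `ω = Z × R` along `Z` is `Z(Z) × R`. -/
theorem lieDerivative_crossProduct (Z : Fin 3 → MvPolynomial (Fin 3) ℂ) (i : Fin 3) :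
    lieDerivative Z (crossProduct Z X i) = crossProduct (fun j => lieDerivative Z (Z j)) X i := by
  fin_cases i <;>
  · simp only [cross_apply, Fin.zero_eta, Fin.mk_one, Fin.reduceFinMk, Matrix.cons_val,
      lieDerivative_sub, lieDerivative_mul, lieDerivative_X]
    ring

/-- An invariant line divides the contraction of its equation with the vector field: `Z` is tangent
to the plane of `ℂ³` over the line. -/
theorem linForm_dvd_dotForm {Z : Fin 3 → MvPolynomial (Fin 3) ℂ} {l : Fin 3 → ℂ} (hl : l ≠ 0)
    (h : FormInvariant (crossProduct Z X) l) : linForm l ∣ dotForm l Z := by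
  have hk : ∀ k, linForm l ∣ X k * dotForm l Z := fun k => by
    refine linForm_dvd_of_eval_eq_zero hl fun x hx => ?_
    -- `(Z × x)·(l × e) = l(Z) (x·e)` when `l(x) = 0`.
    have h0 := h x (crossProduct l (Pi.single k 1)) hx (by simp)
    rw [← h0]
    rw [map_mul, eval_X, eval_dotForm]
    simp only [dotProduct, Fin.sum_univ_three] at hx ⊢
    obtain rfl | rfl | rfl : k = 0 ∨ k = 1 ∨ k = 2 := by omega
    · simp [evalForm, cross_apply, dotProduct, Fin.sum_univ_three]
      linear_combination (eval x (Z 0)) * hx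
    · simp [evalForm, cross_apply, dotProduct, Fin.sum_univ_three]
      linear_combination (eval x (Z 1)) * hx
    · simp [evalForm, cross_apply, dotProduct, Fin.sum_univ_three]
      linear_combination (eval x (Z 2)) * hx
  by_contra hn
  have hX : ∀ k : Fin 3, ∃ c : ℂ, Pi.single k 1 = c • l := fun k => by
    refine exists_smul_of_linForm_dvd hl ?_
    have : linForm (Pi.single k 1) = X k := by
      refine MvPolynomial.funext fun x => ?_
      simp
    rw [this]
    exact ((prime_linForm hl).dvd_or_dvd (hk k)).resolve_right hn
  obtain ⟨a, ha⟩ := hX 0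
  obtain ⟨b, hb⟩ := hX 1
  have h1 := congrFun ha 0
  have h2 := congrFun ha 1
  have h3 := congrFun hb 1
  simp at h1 h2 h3
  rcases h2 with h2 | h2 <;> simp [h2] at h1 h3

/-- The three columns `R`, `Z`, `Z(Z)` of the inflection determinant are tangent to an invariant
plane `l = 0` along it. -/
theorem linForm_dvd_inflectionPolynomial {Z : Fin 3 → MvPolynomial (Fin 3) ℂ} {l : Fin 3 → ℂ}
    (hl : l ≠ 0) (h : FormInvariant (crossProduct Z X) l) :
    linForm l ∣ inflectionPolynomial Z := by
  obtain ⟨q, hq⟩ := linForm_dvd_dotForm hl h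
  have hq' : dotForm l (fun i => lieDerivative Z (Z i)) =
      linForm l * (q * q + lieDerivative Z q) := by
    rw [← lieDerivative_dotForm, hq, lieDerivative_mul, ← dotForm_X, lieDerivative_dotForm]
    simp only [lieDerivative_X]
    rw [hq, dotForm_X]
    ring
  obtain ⟨k, hk⟩ := Function.ne_iff.1 hl
  -- The covector `l` maps the matrix with columns `R`, `Z`, `Z(Z)` to a multiple of `linForm l`.
  have hu : IsUnit (C (l k) : MvPolynomial (Fin 3) ℂ) := (isUnit_iff_ne_zero.2 hk).map C
  rw [← hu.dvd_mul_left]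
  have hX : linForm l = C (l 0) * X 0 + C (l 1) * X 1 + C (l 2) * X 2 := by
    simp [linForm, Fin.sum_univ_three]
  simp only [dotForm, Fin.sum_univ_three] at hq hq'
  rw [inflectionPolynomial_eq]
  generalize lieDerivative Z (Z 0) = W0 at *
  generalize lieDerivative Z (Z 1) = W1 at *
  generalize lieDerivative Z (Z 2) = W2 at *
  generalize q * q + lieDerivative Z q = q' at *
  obtain rfl | rfl | rfl : k = 0 ∨ k = 1 ∨ k = 2 := by omega
  · exact ⟨(Z 1 * W2 - W1 * Z 2) + (X 2 * W1 - X 1 * W2) * q + (X 1 * Z 2 - X 2 * Z 1) * q', by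
      linear_combination (-(Z 1 * W2 - W1 * Z 2)) * hX + (X 2 * W1 - X 1 * W2) * hq +
        (X 1 * Z 2 - X 2 * Z 1) * hq'⟩
  · exact ⟨(Z 2 * W0 - W2 * Z 0) + (X 0 * W2 - X 2 * W0) * q + (X 2 * Z 0 - X 0 * Z 2) * q', by
      linear_combination (-(Z 2 * W0 - W2 * Z 0)) * hX + (X 0 * W2 - X 2 * W0) * hq +
        (X 2 * Z 0 - X 0 * Z 2) * hq'⟩
  · exact ⟨(Z 0 * W1 - W0 * Z 1) + (X 1 * W0 - X 0 * W1) * q + (X 0 * Z 1 - X 1 * Z 0) * q', by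
      linear_combination (-(Z 0 * W1 - W0 * Z 1)) * hX + (X 1 * W0 - X 0 * W1) * hq +
        (X 0 * Z 1 - X 1 * Z 0) * hq'⟩

theorem FoliationForm.exists_coeff_ne_zero {d : ℕ} (ω : FoliationForm d) : ∃ i, ω.coeff i ≠ 0 := by
  by_contra! h
  have := ω.noCommonFactor 0 fun i => by rw [h i]
  simp at this

theorem eq_zero_of_dvd_of_isHomogeneous {f g : MvPolynomial (Fin 3) ℂ} {m n : ℕ}
    (hf : f.IsHomogeneous m) (hg : g.IsHomogeneous n) (hnm : n < m) (h : f ∣ g) : g = 0 := by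
  by_contra hg0
  obtain ⟨q, rfl⟩ := h
  have hf0 := left_ne_zero_of_mul hg0
  have h1 := totalDegree_mul_of_isDomain hf0 (right_ne_zero_of_mul hg0)
  rw [hf.totalDegree hf0, hg.totalDegree hg0] at h1
  omega

/-- The inflection divisor of a foliation of positive degree is not the whole plane. If it were, the
derivative `Z(ω)` would be proportional to `ω`, so for each constant vector `q` the polar
`f = ω·q` would divide `ω i * ω j` times its own derivative along `q`; this derivative would then
vanish. By polarization `∂ᵢ ω_j = -∂_j ωᵢ`, and the Euler identities give `(d + 1) ω = ω`. -/
theorem inflectionPolynomial_ne_zero {d : ℕ} (hd : 1 ≤ d) (ω : FoliationForm d)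
    {Z : Fin 3 → MvPolynomial (Fin 3) ℂ} (hω : ω.coeff = crossProduct Z X) :
    inflectionPolynomial Z ≠ 0 := by
  intro h0
  have hprop : ∀ i j, ω.coeff i * lieDerivative Z (ω.coeff j) =
      ω.coeff j * lieDerivative Z (ω.coeff i) := by
    intro i j
    rw [hω, lieDerivative_crossProduct, lieDerivative_crossProduct]
    rw [inflectionPolynomial_eq] at h0
    fin_cases i <;> fin_cases j <;> simp only [cross_apply, Fin.zero_eta, Fin.mk_one,
      Fin.reduceFinMk, Matrix.cons_val]
    · linear_combination X 2 * h0
    · linear_combination (-(X 1)) * h0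
    · linear_combination (-(X 2)) * h0
    · linear_combination X 0 * h0
    · linear_combination X 1 * h0
    · linear_combination (-(X 0)) * h0
  have hpolar : ∀ q : Fin 3 → ℂ, ∑ i, C (q i) * pderiv i (dotForm q ω.coeff) = 0 := by
    intro q
    set f := dotForm q ω.coeff with hf
    have hfd : f.IsHomogeneous (d + 1) := dotForm_isHomogeneous _ ω.isHomogeneous
    refine eq_zero_of_dvd_of_isHomogeneous hfd (IsHomogeneous.sum _ _ d fun i _ =>
      (show (pderiv i f).IsHomogeneous d from hfd.pderiv).C_mul _) (Nat.lt_succ_self d) ?_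
    refine dvd_of_forall_dvd_mul ω.noCommonFactor fun i =>
      dvd_of_forall_dvd_mul ω.noCommonFactor fun j => ?_
    have hE := hfd.sum_X_mul_pderiv
    have hj : ω.coeff j * lieDerivative Z f = f * lieDerivative Z (ω.coeff j) := by
      rw [hf, lieDerivative_dotForm]
      simp only [dotForm, Fin.sum_univ_three]
      linear_combination C (q 0) * hprop j 0 + C (q 1) * hprop j 1 + C (q 2) * hprop j 2
    have hk : ω.coeff i * ∑ k, C (q k) * pderiv k f = f * pderiv i f +
        (crossProduct (fun k => C (q k)) X i * lieDerivative Z f -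
          (d + 1) * f * crossProduct (fun k => C (q k)) Z i) := by
      have hf' : f = C (q 0) * crossProduct Z X 0 + C (q 1) * crossProduct Z X 1 +
          C (q 2) * crossProduct Z X 2 := by
        simp [hf, dotForm, Fin.sum_univ_three, hω]
      simp only [Fin.sum_univ_three, lieDerivative, nsmul_eq_mul, Nat.cast_add, Nat.cast_one]
        at hE ⊢
      rw [hω]
      obtain rfl | rfl | rfl : i = 0 ∨ i = 1 ∨ i = 2 := by omega
      all_goals simp only [cross_apply, Matrix.cons_val] at hf' ⊢
      · linear_combination (-(pderiv 0 f)) * hf' - (C (q 1) * Z 2 - C (q 2) * Z 1) * hE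
      · linear_combination (-(pderiv 1 f)) * hf' - (C (q 2) * Z 0 - C (q 0) * Z 2) * hE
      · linear_combination (-(pderiv 2 f)) * hf' - (C (q 0) * Z 1 - C (q 1) * Z 0) * hE
    refine ⟨ω.coeff j * pderiv i f + crossProduct (fun k => C (q k)) X i *
      lieDerivative Z (ω.coeff j) - (d + 1) * ω.coeff j * crossProduct (fun k => C (q k)) Z i, ?_⟩
    rw [hk]
    linear_combination crossProduct (fun k => C (q k)) X i * hj
  have hdiag : ∀ i, pderiv i (ω.coeff i) = 0 := fun i => by
    have := hpolar (Pi.single i 1)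
    simpa [dotForm, Pi.single_apply] using this
  have hanti : ∀ i j, pderiv i (ω.coeff j) + pderiv j (ω.coeff i) = 0 := fun i j => by
    have := hpolar (Pi.single i 1 + Pi.single j 1)
    simpa [dotForm, Pi.single_apply, add_mul, Finset.sum_add_distrib, hdiag] using this
  obtain ⟨j, hj⟩ := ω.exists_coeff_ne_zero
  have h1 := (ω.isHomogeneous j).sum_X_mul_pderiv
  have h2 := congrArg (pderiv j) ω.euler
  simp only [map_sum, pderiv_mul, map_zero, Finset.sum_add_distrib, pderiv_X, Pi.single_apply,
    ite_mul, one_mul, zero_mul, Finset.sum_ite_eq', Finset.mem_univ, if_true] at h2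
  have h3 : ∑ i, X i * pderiv i (ω.coeff j) + ∑ i, X i * pderiv j (ω.coeff i) = 0 := by
    rw [← Finset.sum_add_distrib]
    exact Finset.sum_eq_zero fun i _ => by rw [← mul_add, hanti, mul_zero]
  have h4 : (d : MvPolynomial (Fin 3) ℂ) * ω.coeff j = 0 := by
    simp only [nsmul_eq_mul, Nat.cast_add, Nat.cast_one] at h1
    linear_combination h3 - h2 - h1
  exact (mul_ne_zero (Nat.cast_ne_zero.2 (by omega)) hj) h4

theorem isRelPrime_linForm {l m : Fin 3 → ℂ} (hl : l ≠ 0) (h : ∀ c : ℂ, m ≠ c • l) :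
    IsRelPrime (linForm l) (linForm m) :=
  (prime_linForm hl).irreducible.isRelPrime_iff_not_dvd.2 fun hd => by
    obtain ⟨c, hc⟩ := exists_smul_of_linForm_dvd hl hd
    exact h c hc

/-- When there are `3 d` invariant lines, the inflection divisor is their sum. -/
theorem inflectionPolynomial_eq_prod {d : ℕ} (hd : 1 ≤ d) (ω : FoliationForm d)
    {Z : Fin 3 → MvPolynomial (Fin 3) ℂ} (hZ : ∀ i, (Z i).IsHomogeneous d)
    (hω : ω.coeff = crossProduct Z X) {ι : Type*} [Fintype ι] (hι : Fintype.card ι = 3 * d)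
    {l : ι → Fin 3 → ℂ} (hl0 : ∀ i, l i ≠ 0) (hl : Pairwise fun i j => ∀ c : ℂ, l j ≠ c • l i)
    (hinv : ∀ i, FormInvariant ω.coeff (l i)) :
    ∃ c : ℂ, c ≠ 0 ∧ inflectionPolynomial Z = C c * ∏ i, linForm (l i) := by
  have h0 := inflectionPolynomial_ne_zero hd ω hω
  have hrel : Pairwise (Function.onFun IsRelPrime fun i => linForm (l i)) := fun i j hij =>
    isRelPrime_linForm (hl0 i) (hl hij)
  obtain ⟨q, hq⟩ := Fintype.prod_dvd_of_isRelPrime hrel fun i =>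
    linForm_dvd_inflectionPolynomial (hl0 i) (hω ▸ hinv i)
  have hI := (inflectionPolynomial_isHomogeneous hd hZ).totalDegree h0
  have hP : (∏ i, linForm (l i)).IsHomogeneous (3 * d) := by
    have := IsHomogeneous.prod Finset.univ (fun i => linForm (l i)) (fun _ => 1) fun i _ =>
      linForm_isHomogeneous (l i)
    rwa [Finset.sum_const, Finset.card_univ, hι, smul_eq_mul, mul_one] at this
  rw [hq] at h0
  rw [hq, totalDegree_mul_of_isDomain (left_ne_zero_of_mul h0) (right_ne_zero_of_mul h0),
    hP.totalDegree (left_ne_zero_of_mul h0), add_eq_left, totalDegree_eq_zero_iff_eq_C] at hI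
  refine ⟨coeff 0 q, fun hc => right_ne_zero_of_mul h0 (by rw [hI, hc, C_0]), ?_⟩
  rw [hq, mul_comm, ← hI]

/-! ### Vanishing orders and singular points in an affine chart -/

theorem vanishingOrder_mul (p q : MvPolynomial (Fin 2) ℂ) :
    vanishingOrder (p * q) = vanishingOrder p + vanishingOrder q := by
  simp [vanishingOrder, coe_mul, MvPowerSeries.order_mul]

theorem natCast_le_vanishingOrder_iff {n : ℕ} {p : MvPolynomial (Fin 2) ℂ} :
    (n : ℕ∞) ≤ vanishingOrder p ↔ ∀ m : Fin 2 →₀ ℕ, m.degree < n → coeff m p = 0 := by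
  constructor
  · intro h m hm
    have := MvPowerSeries.coeff_of_lt_order (f := (p : MvPowerSeries (Fin 2) ℂ)) (d := m)
      (lt_of_lt_of_le (by exact_mod_cast hm) h)
    simpa using this
  · intro h
    exact MvPowerSeries.nat_le_order fun m hm => by simpa using h m hm

theorem vanishingOrder_add {n : ℕ} {p q : MvPolynomial (Fin 2) ℂ} (hp : n ≤ vanishingOrder p)
    (hq : n ≤ vanishingOrder q) : n ≤ vanishingOrder (p + q) := by
  rw [natCast_le_vanishingOrder_iff] at *
  intro m hm
  rw [coeff_add, hp m hm, hq m hm, add_zero]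

theorem vanishingOrder_neg (p : MvPolynomial (Fin 2) ℂ) :
    vanishingOrder (-p) = vanishingOrder p := by
  have h : ((-p : MvPolynomial (Fin 2) ℂ) : MvPowerSeries (Fin 2) ℂ) = -p := by
    ext m; simp
  rw [vanishingOrder, h, MvPowerSeries.order_neg, vanishingOrder]

theorem vanishingOrder_sub {n : ℕ} {p q : MvPolynomial (Fin 2) ℂ} (hp : n ≤ vanishingOrder p)
    (hq : n ≤ vanishingOrder q) : n ≤ vanishingOrder (p - q) := by
  rw [sub_eq_add_neg]
  exact vanishingOrder_add hp (by rwa [vanishingOrder_neg])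

theorem le_vanishingOrder_mul {m n : ℕ} {p q : MvPolynomial (Fin 2) ℂ}
    (hp : m ≤ vanishingOrder p) (hq : n ≤ vanishingOrder q) :
    (m + n : ℕ) ≤ vanishingOrder (p * q) := by
  rw [vanishingOrder_mul, Nat.cast_add]
  exact add_le_add hp hq

/-- The vanishing order is at least `n + 1` when the polynomial vanishes at the origin and its
partial derivatives have order at least `n` there. -/
theorem succ_le_vanishingOrder_iff {n : ℕ} {p : MvPolynomial (Fin 2) ℂ} :
    ((n + 1 : ℕ) : ℕ∞) ≤ vanishingOrder p ↔
      constantCoeff p = 0 ∧ ∀ j, (n : ℕ∞) ≤ vanishingOrder (pderiv j p) := by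
  simp only [natCast_le_vanishingOrder_iff, constantCoeff_eq]
  constructor
  · intro h
    refine ⟨h 0 (by simp), fun j m hm => ?_⟩
    rw [coeff_pderiv, h _ (by simpa using hm), zero_mul]
  · rintro ⟨h0, h⟩ m hm
    by_cases hm0 : m = 0
    · rwa [hm0]
    obtain ⟨j, hj⟩ := Finsupp.ne_iff.1 hm0
    have e : m - Finsupp.single j 1 + Finsupp.single j 1 = m := by
      refine tsub_add_cancel_of_le ?_
      rw [Finsupp.single_le_iff]
      exact Nat.one_le_iff_ne_zero.2 hj
    have hdeg := congrArg Finsupp.degree e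
    simp only [map_add, Finsupp.degree_single] at hdeg
    have := h j (m - Finsupp.single j 1) (by omega)
    rw [coeff_pderiv, e] at this
    exact (mul_eq_zero.1 this).resolve_right (Nat.cast_add_one_ne_zero _)

theorem one_le_vanishingOrder_iff {p : MvPolynomial (Fin 2) ℂ} :
    ((1 : ℕ) : ℕ∞) ≤ vanishingOrder p ↔ constantCoeff p = 0 := by
  rw [← zero_add 1, succ_le_vanishingOrder_iff]
  simp

theorem two_le_vanishingOrder_iff {p : MvPolynomial (Fin 2) ℂ} :
    ((2 : ℕ) : ℕ∞) ≤ vanishingOrder p ↔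
      constantCoeff p = 0 ∧ ∀ j, constantCoeff (pderiv j p) = 0 := by
  refine (succ_le_vanishingOrder_iff (n := 1)).trans ?_
  simp only [one_le_vanishingOrder_iff]

theorem vanishingOrder_eq_zero {p : MvPolynomial (Fin 2) ℂ} (h : constantCoeff p ≠ 0) :
    vanishingOrder p = 0 := by
  by_contra h0
  exact h (one_le_vanishingOrder_iff.1 (by simpa [Order.one_le_iff_ne_zero] using h0))

theorem vanishingOrder_prod {ι : Type*} (s : Finset ι) (f : ι → MvPolynomial (Fin 2) ℂ) :
    vanishingOrder (∏ i ∈ s, f i) = ∑ i ∈ s, vanishingOrder (f i) := by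
  classical
  induction s using Finset.induction_on with
  | empty => exact vanishingOrder_eq_zero (by simp)
  | insert a s ha ih => rw [Finset.prod_insert ha, Finset.sum_insert ha, vanishingOrder_mul, ih]

/-- The derivative of a polynomial along the planar vector field `A ∂/∂u + B ∂/∂v`. -/
noncomputable def planarDerivative (A B f : MvPolynomial (Fin 2) ℂ) : MvPolynomial (Fin 2) ℂ :=
  A * pderiv 0 f + B * pderiv 1 f

theorem le_vanishingOrder_planarDerivative {m n : ℕ} {A B f : MvPolynomial (Fin 2) ℂ}
    (hA : m ≤ vanishingOrder A) (hB : m ≤ vanishingOrder B)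
    (hf : (n + 1 : ℕ) ≤ vanishingOrder f) :
    (m + n : ℕ) ≤ vanishingOrder (planarDerivative A B f) := by
  have := (succ_le_vanishingOrder_iff.1 hf).2
  exact vanishingOrder_add (le_vanishingOrder_mul hA (this 0)) (le_vanishingOrder_mul hB (this 1))

/-- The identity `u I = D X(A) - A X(D)` between the inflection determinant `I = A X(B) - B X(A)` and
the contact `D = A v - B u` of `X = A ∂/∂u + B ∂/∂v` with the radial field. -/
theorem X_mul_planarInflection (A B : MvPolynomial (Fin 2) ℂ) :
    X 0 * (A * planarDerivative A B B - B * planarDerivative A B A) =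
      (A * X 1 - B * X 0) * planarDerivative A B A -
        A * planarDerivative A B (A * X 1 - B * X 0) := by
  simp only [planarDerivative, map_sub, pderiv_mul, pderiv_X_self,
    pderiv_X_of_ne (show (1 : Fin 2) ≠ 0 by decide),
    pderiv_X_of_ne (show (0 : Fin 2) ≠ 1 by decide)]
  ring

theorem vanishingOrder_X (i : Fin 2) : vanishingOrder (X i) = 1 := by
  refine le_antisymm ?_ (by simpa using one_le_vanishingOrder_iff.2 (by simp))
  by_contra! h
  have h2 : ((2 : ℕ) : ℕ∞) ≤ vanishingOrder (X i) := Order.add_one_le_of_lt h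
  have := (two_le_vanishingOrder_iff.1 h2).2 i
  simp at this

/-- A bound for the vanishing order `r` of the inflection divisor of the planar vector field
`X = A ∂/∂u + B ∂/∂v` at a zero of order at least `m + 1` of `X` where its contact
`A v - B u` with the radial field has order at least `n + 1`. -/
theorem le_of_vanishingOrder_planarInflection {A B : MvPolynomial (Fin 2) ℂ} {m n r : ℕ}
    (hA : (m + 1 : ℕ) ≤ vanishingOrder A) (hB : (m + 1 : ℕ) ≤ vanishingOrder B)
    (hD : (n + 1 : ℕ) ≤ vanishingOrder (A * X 1 - B * X 0))
    (hI : vanishingOrder (A * planarDerivative A B B - B * planarDerivative A B A) = r) :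
    2 * m + n + 1 ≤ r := by
  have h1 : ((2 * m + n + 1 + 1 : ℕ) : ℕ∞) ≤ vanishingOrder
      (X 0 * (A * planarDerivative A B B - B * planarDerivative A B A)) := by
    rw [X_mul_planarInflection]
    refine vanishingOrder_sub ?_ ?_
    · convert le_vanishingOrder_mul hD (le_vanishingOrder_planarDerivative hA hB hA) using 2
      omega
    · convert le_vanishingOrder_mul hA (le_vanishingOrder_planarDerivative hA hB hD) using 2
      omega
  rw [vanishingOrder_mul, vanishingOrder_X, hI] at h1
  have h2 : 2 * m + n + 1 + 1 ≤ 1 + r := by exact_mod_cast h1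
  omega

/-- A planar vector field is non-degenerate at a zero where its contact with the radial field has
order at least that of its inflection divisor, and then both orders are equal. -/
theorem vanishingOrder_contact_and_nondegenerate {A B : MvPolynomial (Fin 2) ℂ} {r : ℕ}
    (hA : constantCoeff A = 0) (hB : constantCoeff B = 0)
    (hI : vanishingOrder (A * planarDerivative A B B - B * planarDerivative A B A) = r)
    (hr : r ≤ vanishingOrder (A * X 1 - B * X 0)) :
    vanishingOrder (A * X 1 - B * X 0) = r ∧
      constantCoeff (pderiv 0 A) * constantCoeff (pderiv 1 B) -
        constantCoeff (pderiv 1 A) * constantCoeff (pderiv 0 B) ≠ 0 := by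
  have hA1 := one_le_vanishingOrder_iff.2 hA
  have hB1 := one_le_vanishingOrder_iff.2 hB
  refine ⟨le_antisymm ?_ hr, fun hdet => ?_⟩
  · by_contra! h
    have := le_of_vanishingOrder_planarInflection (m := 0) (n := r) hA1 hB1
      (Order.add_one_le_of_lt h) hI
    omega
  have hX : ∀ j, ((1 : ℕ) : ℕ∞) ≤ vanishingOrder (X j : MvPolynomial (Fin 2) ℂ) := fun j => by
    simp [vanishingOrder_X]
  have hD2 : ((1 + 1 : ℕ) : ℕ∞) ≤ vanishingOrder (A * X 1 - B * X 0) :=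
    vanishingOrder_sub (le_vanishingOrder_mul hA1 (hX 1)) (le_vanishingOrder_mul hB1 (hX 0))
  have hr2 := le_of_vanishingOrder_planarInflection (m := 0) hA1 hB1 hD2 hI
  have e10 := pderiv_X_of_ne (R := ℂ) (show (1 : Fin 2) ≠ 0 by decide)
  have e01 := pderiv_X_of_ne (R := ℂ) (show (0 : Fin 2) ≠ 1 by decide)
  obtain hr3 | hr3 : r = 2 ∨ 3 ≤ r := by omega
  · -- By Cayley-Hamilton, `X(X)` agrees with `tr L • X` up to order two when `det L = 0`.
    set t := constantCoeff (pderiv 0 A) + constantCoeff (pderiv 1 B) with ht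
    have hα : ((2 : ℕ) : ℕ∞) ≤ vanishingOrder (planarDerivative A B A - C t * A) := by
      rw [two_le_vanishingOrder_iff]
      refine ⟨by simp [planarDerivative, hA, hB], fun j => ?_⟩
      obtain rfl | rfl : j = 0 ∨ j = 1 := by omega
      · simp [planarDerivative, hA, hB, ht]
        linear_combination -hdet
      · simp [planarDerivative, hA, hB, ht]
        ring
    have hβ : ((2 : ℕ) : ℕ∞) ≤ vanishingOrder (planarDerivative A B B - C t * B) := by
      rw [two_le_vanishingOrder_iff]
      refine ⟨by simp [planarDerivative, hA, hB], fun j => ?_⟩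
      obtain rfl | rfl : j = 0 ∨ j = 1 := by omega
      · simp [planarDerivative, hA, hB, ht]
        ring
      · simp [planarDerivative, hA, hB, ht]
        linear_combination -hdet
    have h3 := vanishingOrder_sub (le_vanishingOrder_mul hA1 hβ) (le_vanishingOrder_mul hB1 hα)
    have e : A * (planarDerivative A B B - C t * B) - B * (planarDerivative A B A - C t * A) =
        A * planarDerivative A B B - B * planarDerivative A B A := by ring
    rw [e, hI, Nat.cast_le] at h3
    omega
  · -- The linear part is scalar, hence zero, and the field vanishes to order two.
    have hD3 : ((2 + 1 : ℕ) : ℕ∞) ≤ vanishingOrder (A * X 1 - B * X 0) :=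
      le_trans (by exact_mod_cast hr3) hr
    have hD' := fun i => (two_le_vanishingOrder_iff.1 ((succ_le_vanishingOrder_iff.1 hD3).2 i)).2
    have h00 := hD' 0 0
    have h01 := hD' 0 1
    have h11 := hD' 1 1
    simp [e10, e01] at h00 h01 h11
    have ha : constantCoeff (pderiv 0 A) = 0 := by
      rw [h00, h11, ← sub_eq_zero.1 h01] at hdet
      simpa using hdet
    rw [ha, zero_sub, neg_eq_zero] at h01
    have hA2 := two_le_vanishingOrder_iff.2 ⟨hA, fun j => by
      obtain rfl | rfl : j = 0 ∨ j = 1 := by omega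
      exacts [ha, h11]⟩
    have hB2 := two_le_vanishingOrder_iff.2 ⟨hB, fun j => by
      obtain rfl | rfl : j = 0 ∨ j = 1 := by omega
      exacts [h00, h01]⟩
    obtain ⟨n, rfl⟩ : ∃ n, r = n + 1 := ⟨r - 1, by omega⟩
    have := le_of_vanishingOrder_planarInflection (m := 1) hA2 hB2 hr hI
    omega

/-- Restriction of a polynomial to the affine chart `(u, v) ↦ (u, v, 1)`. -/
noncomputable def dehom : MvPolynomial (Fin 3) ℂ →ₐ[ℂ] MvPolynomial (Fin 2) ℂ :=
  aeval ![X 0, X 1, 1]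

theorem dehom_X_zero : dehom (X 0) = X 0 := by simp [dehom]

theorem dehom_X_one : dehom (X 1) = X 1 := by simp [dehom]

theorem dehom_X_two : dehom (X 2) = 1 := by simp [dehom]

theorem constantCoeff_dehom (f : MvPolynomial (Fin 3) ℂ) :
    constantCoeff (dehom f) = eval ![0, 0, 1] f := by
  induction f using MvPolynomial.induction_on with
  | C a => simp [dehom]
  | add p q hp hq => rw [map_add, map_add, map_add, hp, hq]
  | mul_X p i hp =>
    rw [map_mul, map_mul, map_mul, hp]
    congr 1
    fin_cases i <;> simp [dehom]

theorem pderiv_dehom (f : MvPolynomial (Fin 3) ℂ) (j : Fin 2) :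
    pderiv j (dehom f) = dehom (pderiv j.castSucc f) := by
  induction f using MvPolynomial.induction_on with
  | C a => simp [dehom]
  | add p q hp hq => simp only [map_add, hp, hq]
  | mul_X p i hp =>
    rw [map_mul, pderiv_mul, pderiv_mul, hp, map_add, map_mul, map_mul]
    congr 2
    fin_cases i <;> fin_cases j <;> simp [dehom, pderiv_X]

theorem dehom_linForm (l : Fin 3 → ℂ) :
    dehom (linForm l) = C (l 0) * X 0 + C (l 1) * X 1 + C (l 2) := by
  simp [linForm, Fin.sum_univ_three, dehom]

theorem vanishingOrder_dehom_linForm {l : Fin 3 → ℂ} (hl : l ≠ 0) :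
    vanishingOrder (dehom (linForm l)) = if l 2 = 0 then 1 else 0 := by
  rw [dehom_linForm]
  split_ifs with h
  · refine le_antisymm ?_ (by simpa using one_le_vanishingOrder_iff.2 (by simp [h]))
    by_contra! h1
    have h2 := (two_le_vanishingOrder_iff.1 (Order.add_one_le_of_lt h1)).2
    refine hl (funext fun i => ?_)
    have h3 := h2 0
    have h4 := h2 1
    simp [pderiv_X] at h3 h4
    obtain rfl | rfl | rfl : i = 0 ∨ i = 1 ∨ i = 2 := by omega
    exacts [h3, h4, h]
  · exact vanishingOrder_eq_zero (by simpa using h)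

theorem vanishingOrder_dehom_prod_linForm {ι : Type*} (s : Finset ι) {l : ι → Fin 3 → ℂ}
    (hl : ∀ i, l i ≠ 0) : vanishingOrder (dehom (∏ i ∈ s, linForm (l i))) =
      ((s.filter fun i => l i 2 = 0).card : ℕ) := by
  rw [map_prod, vanishingOrder_prod, Finset.sum_congr rfl fun i _ =>
    vanishingOrder_dehom_linForm (hl i)]
  simp

/-- In the chart `z = 1`, the inflection divisor is that of the planar vector field
`(-ω₁, ω₀)`: on `ℂ³` the field `z Z - Z₂ R` has components `(-ω₁, ω₀, 0)`. -/
theorem sq_X_two_mul_inflectionPolynomial {d : ℕ} {Z : Fin 3 → MvPolynomial (Fin 3) ℂ}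
    (hZ : ∀ i, (Z i).IsHomogeneous d) {ω : Fin 3 → MvPolynomial (Fin 3) ℂ}
    (hω : ω = crossProduct Z X) :
    X 2 ^ 2 * inflectionPolynomial Z =
      ω 1 * (ω 1 * pderiv 0 (ω 0) - ω 0 * pderiv 1 (ω 0)) -
        ω 0 * (ω 1 * pderiv 0 (ω 1) - ω 0 * pderiv 1 (ω 1)) := by
  have e := fun i => (hZ i).sum_X_mul_pderiv
  have e0 := e 0
  have e1 := e 1
  have e2 := e 2
  have p10 := pderiv_X_of_ne (R := ℂ) (show (1 : Fin 3) ≠ 0 by decide)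
  have p01 := pderiv_X_of_ne (R := ℂ) (show (0 : Fin 3) ≠ 1 by decide)
  have p20 := pderiv_X_of_ne (R := ℂ) (show (2 : Fin 3) ≠ 0 by decide)
  have p21 := pderiv_X_of_ne (R := ℂ) (show (2 : Fin 3) ≠ 1 by decide)
  simp only [Fin.sum_univ_three, nsmul_eq_mul] at e0 e1 e2
  rw [inflectionPolynomial_eq, hω]
  simp only [cross_apply, Matrix.cons_val, lieDerivative, Fin.sum_univ_three, map_sub, pderiv_mul,
    pderiv_X_self, p10, p01, p20, p21]
  generalize pderiv 0 (Z 0) = a00 at *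
  generalize pderiv 0 (Z 1) = a01 at *
  generalize pderiv 0 (Z 2) = a02 at *
  generalize pderiv 1 (Z 0) = a10 at *
  generalize pderiv 1 (Z 1) = a11 at *
  generalize pderiv 1 (Z 2) = a12 at *
  generalize pderiv 2 (Z 0) = a20 at *
  generalize pderiv 2 (Z 1) = a21 at *
  generalize pderiv 2 (Z 2) = a22 at *
  linear_combination (-(Z 2 * X 2 * (Z 1 * X 2 - Z 2 * X 1))) * e0 +
    (Z 2 * X 2 * (Z 0 * X 2 - Z 2 * X 0)) * e1 -
    (Z 2 * X 2 * (X 1 * Z 0 - X 0 * Z 1)) * e2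

theorem dotForm_single (p : Fin 3) (ω : Fin 3 → MvPolynomial (Fin 3) ℂ) :
    dotForm (Pi.single p 1) ω = ω p := by
  simp [dotForm, Pi.single_apply]

theorem eval_dotForm_eq_evalForm (p x : Fin 3 → ℂ) (ω : Fin 3 → MvPolynomial (Fin 3) ℂ) :
    eval x (dotForm p ω) = evalForm ω x p := by
  rw [eval_dotForm, evalForm, dotProduct_comm]

/-- The invariant lines through a point divide the polar of the foliation at this point. -/
theorem prod_linForm_dvd_dotForm {ω : Fin 3 → MvPolynomial (Fin 3) ℂ} {ι : Type*}
    {l : ι → Fin 3 → ℂ} (hl0 : ∀ i, l i ≠ 0) (hl : Pairwise fun i j => ∀ c : ℂ, l j ≠ c • l i)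
    (hinv : ∀ i, FormInvariant ω (l i)) {p : Fin 3 → ℂ} {s : Finset ι}
    (hs : ∀ i ∈ s, l i ⬝ᵥ p = 0) : ∏ i ∈ s, linForm (l i) ∣ dotForm p ω := by
  refine Finset.prod_dvd_of_isRelPrime (fun i _ j _ hij => isRelPrime_linForm (hl0 i) (hl hij))
    fun i hi => linForm_dvd_of_eval_eq_zero (hl0 i) fun x hx => ?_
  rw [eval_dotForm_eq_evalForm]
  exact hinv i x p hx (hs i hi)

/-- At a singular point `(0 : 0 : 1)` of a foliation with `3 d` invariant lines, the contact with
lines through this point has the number of invariant lines through it as vanishing order, and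
the linear part of the foliation is invertible. -/
theorem vanishingOrder_and_nondegenerate_of_sing {d : ℕ} (hd : 1 ≤ d) (ω : FoliationForm d)
    {Z : Fin 3 → MvPolynomial (Fin 3) ℂ} (hZ : ∀ i, (Z i).IsHomogeneous d)
    (hω : ω.coeff = crossProduct Z X) {ι : Type*} [Fintype ι] (hι : Fintype.card ι = 3 * d)
    {l : ι → Fin 3 → ℂ} (hl0 : ∀ i, l i ≠ 0) (hl : Pairwise fun i j => ∀ c : ℂ, l j ≠ c • l i)
    (hinv : ∀ i, FormInvariant ω.coeff (l i)) (hsing : ∀ i, eval ![0, 0, 1] (ω.coeff i) = 0) :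
    vanishingOrder (dehom (ω.coeff 2)) = ((Finset.univ.filter fun i => l i 2 = 0).card : ℕ) ∧
      eval ![0, 0, 1] (pderiv 0 (ω.coeff 0)) * eval ![0, 0, 1] (pderiv 1 (ω.coeff 1)) -
        eval ![0, 0, 1] (pderiv 0 (ω.coeff 1)) * eval ![0, 0, 1] (pderiv 1 (ω.coeff 0)) ≠ 0 := by
  obtain ⟨c, hc, hI⟩ := inflectionPolynomial_eq_prod hd ω hZ hω hι hl0 hl hinv
  set r := (Finset.univ.filter fun i => l i 2 = 0).card with hr
  set A := dehom (ω.coeff 1) with hA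
  set B := -dehom (ω.coeff 0) with hB
  have hD : A * X 1 - B * X 0 = -dehom (ω.coeff 2) := by
    have := congrArg dehom ω.euler
    simp only [Fin.sum_univ_three, map_add, map_mul, dehom_X_zero, dehom_X_one, dehom_X_two,
      map_zero] at this
    rw [hA, hB]
    linear_combination this
  have hi : A * planarDerivative A B B - B * planarDerivative A B A =
      -dehom (inflectionPolynomial Z) := by
    have := congrArg dehom (sq_X_two_mul_inflectionPolynomial hZ hω)
    rw [map_mul, map_pow, dehom_X_two, one_pow, one_mul] at this
    rw [this]
    simp only [hA, hB, planarDerivative, map_sub, map_mul, map_neg, pderiv_dehom]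
    simp only [Fin.castSucc_zero, Fin.castSucc_one]
    ring
  have hiord : vanishingOrder (A * planarDerivative A B B - B * planarDerivative A B A) = r := by
    rw [hi, vanishingOrder_neg, hI, map_mul, vanishingOrder_mul,
      vanishingOrder_dehom_prod_linForm _ hl0, vanishingOrder_eq_zero, zero_add]
    simpa [constantCoeff_dehom] using hc
  have hrD : (r : ℕ∞) ≤ vanishingOrder (A * X 1 - B * X 0) := by
    obtain ⟨e, he⟩ := prod_linForm_dvd_dotForm (p := Pi.single 2 1)
      (s := Finset.univ.filter fun i => l i 2 = 0) hl0 hl hinv (fun i hi => by simpa using hi)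
    rw [dotForm_single] at he
    rw [hD, vanishingOrder_neg, he, map_mul, vanishingOrder_mul,
      vanishingOrder_dehom_prod_linForm _ hl0, Finset.filter_filter]
    simp only [and_self]
    exact le_self_add
  obtain ⟨h1, h2⟩ := vanishingOrder_contact_and_nondegenerate
    (by simp [hA, constantCoeff_dehom, hsing]) (by simp [hB, constantCoeff_dehom, hsing]) hiord hrD
  refine ⟨by rwa [hD, vanishingOrder_neg] at h1, fun h => h2 ?_⟩
  simp only [hA, hB, map_neg, pderiv_dehom, constantCoeff_dehom, Fin.castSucc_zero,
    Fin.castSucc_one]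
  linear_combination h

/-! ### Tangency order and Milnor number from local data -/

theorem coeff_jet (k : ℕ) (p : MvPolynomial (Fin 2) ℂ) (m : Fin 2 →₀ ℕ) :
    coeff m (jet k p) = if m.degree ≤ k then coeff m p else 0 := by
  simp [jet, coeff_sum, coeff_homogeneousComponent]

theorem le_vanishingOrder_sub_jet (k : ℕ) (p : MvPolynomial (Fin 2) ℂ) :
    (k + 1 : ℕ) ≤ vanishingOrder (p - jet k p) := by
  rw [natCast_le_vanishingOrder_iff]
  intro m hm
  rw [coeff_sub, coeff_jet, if_pos (by omega), sub_self]

theorem totalDegree_jet_le (k : ℕ) (p : MvPolynomial (Fin 2) ℂ) : (jet k p).totalDegree ≤ k := by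
  refine (totalDegree_finsetSum _ _).trans (Finset.sup_le fun i hi => ?_)
  exact (homogeneousComponent_isHomogeneous i p).totalDegree_le.trans
    (Nat.lt_succ_iff.1 (Finset.mem_range.1 hi))

/-- The determinant of the `k`-jet of a planar vector field and the radial field is nonzero exactly
when `k + 1` is at least the vanishing order of the determinant of the field itself. -/
theorem det_jet_ne_zero_iff {A B : MvPolynomial (Fin 2) ℂ} {n k : ℕ}
    (h : vanishingOrder (A * X 1 - B * X 0) = (n + 1 : ℕ)) :
    Matrix.det !![jet k A, X 0; jet k B, X 1] ≠ 0 ↔ n ≤ k := by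
  have hX : ∀ j, ((1 : ℕ) : ℕ∞) ≤ vanishingOrder (X j : MvPolynomial (Fin 2) ℂ) := fun j => by
    simp [vanishingOrder_X]
  have hdet : Matrix.det !![jet k A, X 0; jet k B, X 1] = jet k A * X 1 - jet k B * X 0 := by
    rw [Matrix.det_fin_two_of]; ring
  have hsub : ((k + 1 + 1 : ℕ) : ℕ∞) ≤ vanishingOrder
      ((A * X 1 - B * X 0) - (jet k A * X 1 - jet k B * X 0)) := by
    rw [show (A * X 1 - B * X 0) - (jet k A * X 1 - jet k B * X 0) =
      (A - jet k A) * X 1 - (B - jet k B) * X 0 by ring]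
    exact vanishingOrder_sub (le_vanishingOrder_mul (le_vanishingOrder_sub_jet k A) (hX 1))
      (le_vanishingOrder_mul (le_vanishingOrder_sub_jet k B) (hX 0))
  rw [hdet]
  constructor
  · intro h0
    by_contra! hk
    have h1 : ((k + 1 + 1 : ℕ) : ℕ∞) ≤ vanishingOrder (A * X 1 - B * X 0) := by
      rw [h]; exact_mod_cast (by omega)
    have h2 := vanishingOrder_sub h1 hsub
    rw [sub_sub_cancel, natCast_le_vanishingOrder_iff] at h2
    have h3 : (jet k A * X 1 - jet k B * X 0).totalDegree ≤ k + 1 := by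
      refine (totalDegree_sub _ _).trans (max_le ?_ ?_) <;>
      · refine (totalDegree_mul _ _).trans ?_
        rw [totalDegree_X]
        exact Nat.add_le_add_right (totalDegree_jet_le _ _) 1
    refine h0 (MvPolynomial.ext _ _ fun m => ?_)
    by_cases hm : m.degree < k + 1 + 1
    · exact h2 m hm
    · exact coeff_eq_zero_of_totalDegree_lt (by
        change _ < m.degree
        omega)
  · intro hk h0
    rw [h0, sub_zero, h, Nat.cast_le] at hsub
    omega

/-- The tangency order is one less than the vanishing order of the contact with the radial field, a
polynomial which up to sign is the last coefficient of the `1`-form in a frame at the point. -/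
theorem Foliation.tau_eq {d : ℕ} (F : Foliation d) (s : Plane) {n : ℕ}
    (h : vanishingOrder (dehom (pullbackForm (frameAt s).val F.form.coeff 2)) = (n + 1 : ℕ)) :
    F.tau s = n := by
  set ω := F.form.pullback (frameAt s) with hω
  have hA : F.localField (frameAt s) 0 = dehom (ω.coeff 1) := rfl
  have hB : F.localField (frameAt s) 1 = -dehom (ω.coeff 0) := rfl
  have hD : dehom (ω.coeff 1) * X 1 - -dehom (ω.coeff 0) * X 0 = -dehom (ω.coeff 2) := by
    have := congrArg dehom ω.euler
    simp only [Fin.sum_univ_three, map_add, map_mul, dehom_X_zero, dehom_X_one, dehom_X_two,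
      map_zero] at this
    linear_combination this
  have h' : vanishingOrder (dehom (ω.coeff 1) * X 1 - -dehom (ω.coeff 0) * X 0) =
      (n + 1 : ℕ) := by
    rw [hD, vanishingOrder_neg]; exact h
  have hν : F.nu s ≤ n := by
    by_contra! hn
    rw [Foliation.nu, hA, hB, lt_min_iff] at hn
    have hX : ∀ j, ((1 : ℕ) : ℕ∞) ≤ vanishingOrder (X j : MvPolynomial (Fin 2) ℂ) := fun j => by
      simp [vanishingOrder_X]
    have h1 : ((n + 1 : ℕ) : ℕ∞) ≤ vanishingOrder (dehom (ω.coeff 1)) :=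
      Order.add_one_le_of_lt hn.1
    have h2 : ((n + 1 : ℕ) : ℕ∞) ≤ vanishingOrder (-dehom (ω.coeff 0)) :=
      Order.add_one_le_of_lt hn.2
    have h3 := vanishingOrder_sub (le_vanishingOrder_mul h1 (hX 1))
      (le_vanishingOrder_mul h2 (hX 0))
    rw [h', Nat.cast_le] at h3
    omega
  have hset : {k : ℕ | F.nu s ≤ k ∧
      Matrix.det !![jet k (F.localField (frameAt s) 0), X 0;
                    jet k (F.localField (frameAt s) 1), X 1] ≠ 0} = Set.Ici n := by
    ext k
    rw [Set.mem_ofPred_eq, hA, hB, det_jet_ne_zero_iff h', Set.mem_Ici]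
    exact ⟨fun hk => hk.2, fun hk => ⟨hν.trans (by exact_mod_cast hk), hk⟩⟩
  rw [Foliation.tau, hset, csInf_Ici]

theorem exists_eq_C_add_X_mul (p : MvPolynomial (Fin 2) ℂ) :
    ∃ a b, p = C (constantCoeff p) + X 0 * a + X 1 * b := by
  induction p using MvPolynomial.induction_on with
  | C c => exact ⟨0, 0, by simp⟩
  | add p q hp hq =>
    obtain ⟨a, b, h⟩ := hp
    obtain ⟨a', b', h'⟩ := hq
    refine ⟨a + a', b + b', ?_⟩
    rw [map_add, C_add]
    linear_combination h + h'
  | mul_X p i =>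
    obtain rfl | rfl : i = 0 ∨ i = 1 := by omega
    · exact ⟨p, 0, by simp [mul_comm]⟩
    · exact ⟨0, p, by simp [mul_comm]⟩

theorem isUnit_algebraMap_localRing {p : MvPolynomial (Fin 2) ℂ} (h : constantCoeff p ≠ 0) :
    IsUnit (algebraMap (MvPolynomial (Fin 2) ℂ) LocalRing p) :=
  IsLocalization.map_units (M := (RingHom.ker
    (constantCoeff : MvPolynomial (Fin 2) ℂ →+* ℂ)).primeCompl) LocalRing ⟨p, h⟩

/-- Two polynomials vanishing at the origin with independent linear parts generate the maximal ideal
of the local ring, so the quotient is the residue field `ℂ`. -/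
theorem rank_localRing_quotient_eq_one {f : Fin 2 → MvPolynomial (Fin 2) ℂ}
    (h0 : ∀ i, constantCoeff (f i) = 0)
    (hdet : constantCoeff (pderiv 0 (f 0)) * constantCoeff (pderiv 1 (f 1)) -
      constantCoeff (pderiv 1 (f 0)) * constantCoeff (pderiv 0 (f 1)) ≠ 0) :
    Module.rank ℂ (LocalRing ⧸ Ideal.span
      (Set.range fun i => algebraMap (MvPolynomial (Fin 2) ℂ) LocalRing (f i))) = 1 := by
  set φ := algebraMap (MvPolynomial (Fin 2) ℂ) LocalRing with hφ
  set I := Ideal.span (Set.range fun i => φ (f i)) with hI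
  have hf : ∀ i, φ (f i) ∈ I := fun i => Ideal.subset_span ⟨i, rfl⟩
  obtain ⟨a, b, hab⟩ := exists_eq_C_add_X_mul (f 0)
  obtain ⟨a', b', hab'⟩ := exists_eq_C_add_X_mul (f 1)
  rw [h0, C_0, zero_add] at hab hab'
  have hu : IsUnit (φ (a * b' - b * a')) := by
    refine isUnit_algebraMap_localRing fun h => hdet ?_
    rw [hab, hab']
    simpa [pderiv_X] using h
  -- Cramer's rule: both coordinates belong to the ideal.
  have hX0 : φ (X 0) ∈ I := by
    rw [← Ideal.unit_mul_mem_iff_mem I hu, ← map_mul,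
      show (a * b' - b * a') * X 0 = b' * f 0 - b * f 1 by rw [hab, hab']; ring, map_sub, map_mul,
      map_mul]
    exact I.sub_mem (I.mul_mem_left _ (hf 0)) (I.mul_mem_left _ (hf 1))
  have hX1 : φ (X 1) ∈ I := by
    rw [← Ideal.unit_mul_mem_iff_mem I hu, ← map_mul,
      show (a * b' - b * a') * X 1 = a * f 1 - a' * f 0 by rw [hab, hab']; ring, map_sub, map_mul,
      map_mul]
    exact I.sub_mem (I.mul_mem_left _ (hf 1)) (I.mul_mem_left _ (hf 0))
  have hconst : ∀ p,
      Ideal.Quotient.mk I (φ p) = algebraMap ℂ (LocalRing ⧸ I) (constantCoeff p) := by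
    intro p
    obtain ⟨q, q', hq⟩ := exists_eq_C_add_X_mul p
    have e : algebraMap ℂ (LocalRing ⧸ I) (constantCoeff p) =
        Ideal.Quotient.mk I (φ (C (constantCoeff p))) := rfl
    rw [e, Ideal.Quotient.eq, ← map_sub]
    rw [show p - C (constantCoeff p) = X 0 * q + X 1 * q' by linear_combination hq, map_add,
      map_mul, map_mul]
    exact I.add_mem (I.mul_mem_right _ hX0) (I.mul_mem_right _ hX1)
  have hle : I ≤ IsLocalRing.maximalIdeal LocalRing := by
    rw [hI, Ideal.span_le]
    rintro _ ⟨i, rfl⟩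
    exact (IsLocalization.AtPrime.to_map_mem_maximal_iff LocalRing (RingHom.ker
      (constantCoeff : MvPolynomial (Fin 2) ℂ →+* ℂ)) (f i)).2 (h0 i)
  have hne : I ≠ ⊤ := fun h => IsLocalRing.maximalIdeal.isMaximal LocalRing |>.ne_top
    (top_le_iff.1 (h ▸ hle))
  have : Nontrivial (LocalRing ⧸ I) := Ideal.Quotient.nontrivial_iff.2 hne
  have hbij : Function.Bijective (Algebra.linearMap ℂ (LocalRing ⧸ I)) := by
    refine ⟨(algebraMap ℂ (LocalRing ⧸ I)).injective, fun y => ?_⟩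
    obtain ⟨x, rfl⟩ := Ideal.Quotient.mk_surjective y
    obtain ⟨p, s, rfl⟩ := IsLocalization.exists_mk'_eq (RingHom.ker
      (constantCoeff : MvPolynomial (Fin 2) ℂ →+* ℂ)).primeCompl x
    have hs : constantCoeff s.1 ≠ 0 := s.2
    refine ⟨constantCoeff p / constantCoeff s.1, ?_⟩
    have h1 := congrArg (Ideal.Quotient.mk I) (IsLocalization.mk'_spec LocalRing p s)
    rw [map_mul, hconst, hconst] at h1
    have hs' : IsUnit (algebraMap ℂ (LocalRing ⧸ I) (constantCoeff s.1)) :=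
      (isUnit_iff_ne_zero.2 hs).map _
    refine hs'.mul_right_cancel ?_
    rw [h1, Algebra.linearMap_apply, ← map_mul, div_mul_cancel₀ _ hs]
  rw [← (LinearEquiv.ofBijective _ hbij).rank_eq, Module.rank_self]

theorem Foliation.linearPart_apply {d : ℕ} (F : Foliation d) (g : GL (Fin 3) ℂ) (i j : Fin 2) :
    F.linearPart g i j = constantCoeff (pderiv j (F.localField g i)) := by
  rw [Foliation.linearPart, Matrix.of_apply, constantCoeff_eq, coeff_pderiv]
  simp

theorem Foliation.milnor_eq_one {d : ℕ} (F : Foliation d) (s : Plane)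
    (h0 : ∀ i, constantCoeff (F.localField (frameAt s) i) = 0)
    (hdet : (F.linearPart (frameAt s)).det ≠ 0) : F.milnor s = 1 := by
  rw [Foliation.milnor, rank_localRing_quotient_eq_one h0, map_one]
  simpa [Matrix.det_fin_two, Foliation.linearPart_apply] using hdet

/-! ### Degeneration of a form along an invariant line -/

/-- The `1`-form `l(R) θ - θ(R) l`, where `R` is the radial field, that is `Z × R` with `Z = l × θ`:
the general form of a `1`-form satisfying the Euler condition and leaving the line `l = 0`
invariant. -/
noncomputable def lineForm (l : Fin 3 → ℂ) (θ : Fin 3 → MvPolynomial (Fin 3) ℂ) :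
    Fin 3 → MvPolynomial (Fin 3) ℂ := fun i => linForm l * θ i - C (l i) * ∑ k, X k * θ k

/-- The vector field `l × θ`, tangent to the planes `l = const`. -/
noncomputable def lineField (l : Fin 3 → ℂ) (θ : Fin 3 → MvPolynomial (Fin 3) ℂ) :
    Fin 3 → MvPolynomial (Fin 3) ℂ := crossProduct (fun i => C (l i)) θ

theorem lineForm_eq_crossProduct (l : Fin 3 → ℂ) (θ : Fin 3 → MvPolynomial (Fin 3) ℂ) :
    lineForm l θ = crossProduct (lineField l θ) X := by
  ext1 i
  obtain rfl | rfl | rfl : i = 0 ∨ i = 1 ∨ i = 2 := by omega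
  all_goals
    simp only [lineForm, lineField, linForm, cross_apply, Matrix.cons_val, Fin.sum_univ_three]
    ring

theorem dotForm_lineField (l : Fin 3 → ℂ) (θ : Fin 3 → MvPolynomial (Fin 3) ℂ) :
    dotForm l (lineField l θ) = 0 := by
  simp only [dotForm, lineField, cross_apply, Matrix.cons_val, Fin.sum_univ_three]
  ring

theorem lineField_isHomogeneous (l : Fin 3 → ℂ) {θ : Fin 3 → MvPolynomial (Fin 3) ℂ} {n : ℕ}
    (hθ : ∀ i, (θ i).IsHomogeneous n) (i : Fin 3) : (lineField l θ i).IsHomogeneous n := by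
  obtain rfl | rfl | rfl : i = 0 ∨ i = 1 ∨ i = 2 := by omega
  all_goals exact ((hθ _).C_mul _).sub ((hθ _).C_mul _)

theorem evalForm_lineForm (l : Fin 3 → ℂ) (θ : Fin 3 → MvPolynomial (Fin 3) ℂ)
    (x v : Fin 3 → ℂ) :
    evalForm (lineForm l θ) x v = (l ⬝ᵥ x) * evalForm θ x v - (l ⬝ᵥ v) * evalForm θ x x := by
  simp [evalForm, lineForm, dotProduct, Fin.sum_univ_three]
  ring

theorem lineForm_isHomogeneous (l : Fin 3 → ℂ) {θ : Fin 3 → MvPolynomial (Fin 3) ℂ} {d : ℕ}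
    (hθ : ∀ i, (θ i).IsHomogeneous d) (i : Fin 3) : (lineForm l θ i).IsHomogeneous (d + 1) := by
  rw [add_comm]
  refine ((linForm_isHomogeneous l).mul (hθ i)).sub (.C_mul (.sum _ _ _ fun k _ => ?_) _)
  exact (isHomogeneous_X _ k).mul (hθ k)

theorem euler_lineForm (l : Fin 3 → ℂ) (θ : Fin 3 → MvPolynomial (Fin 3) ℂ) :
    ∑ i, X i * lineForm l θ i = 0 := by
  simp only [lineForm, linForm, Fin.sum_univ_three]
  ring

theorem homogeneousComponent_mul_of_isHomogeneous {σ : Type*} {p q : MvPolynomial σ ℂ} {m n : ℕ}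
    (hp : p.IsHomogeneous m) :
    homogeneousComponent (m + n) (p * q) = p * homogeneousComponent n q := by
  conv_lhs => rw [← sum_homogeneousComponent q, Finset.mul_sum, map_sum]
  have h : ∀ i, homogeneousComponent (m + n) (p * homogeneousComponent i q) =
      if i = n then p * homogeneousComponent i q else 0 := fun i => by
    rw [homogeneousComponent_of_mem (hp.mul (homogeneousComponent_isHomogeneous i q))]
    simp only [add_right_inj, eq_comm]
  simp only [h, Finset.sum_ite_eq', Finset.mem_range]
  split_ifs with hn
  · rfl
  · rw [homogeneousComponent_eq_zero _ _ (by omega), mul_zero]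

theorem C_mul_C_add_eq_one {l o : Fin 3 → ℂ} (ho : l ⬝ᵥ o = 1) :
    (C (l 0) * C (o 0) + C (l 1) * C (o 1) + C (l 2) * C (o 2) : MvPolynomial (Fin 3) ℂ) = 1 := by
  have h := congrArg (C (σ := Fin 3)) ho
  simpa only [dotProduct, Fin.sum_univ_three, C_add, C_mul, C_1] using h

/-- A foliation leaving the line `l = 0` invariant is defined by a form `lineForm l θ`, where `θ` may
be chosen to vanish on a vector `o` transverse to the line. -/
theorem FoliationForm.exists_eq_lineForm {d : ℕ} (ω : FoliationForm d) {l o : Fin 3 → ℂ}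
    (ho : l ⬝ᵥ o = 1) (hinv : FormInvariant ω.coeff l) :
    ∃ θ : Fin 3 → MvPolynomial (Fin 3) ℂ, (∀ i, (θ i).IsHomogeneous d) ∧ dotForm o θ = 0 ∧
      ω.coeff = lineForm l θ := by
  have hl : l ≠ 0 := by rintro rfl; simp at ho
  have hdvd : ∀ i, linForm l ∣ ω.coeff i - C (l i) * dotForm o ω.coeff := fun i => by
    refine linForm_dvd_of_eval_eq_zero hl fun x hx => ?_
    have h := hinv x (Pi.single i 1 - l i • o) hx (by simp [dotProduct_sub, ho])
    rw [map_sub, map_mul, eval_C, eval_dotForm_eq_evalForm, ← h]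
    simp [evalForm, dotProduct_sub]
  choose q hq using hdvd
  set φ := dotForm o ω.coeff with hφ
  have hθ : ∀ i, ω.coeff i - C (l i) * φ = linForm l * homogeneousComponent d (q i) := fun i => by
    rw [← homogeneousComponent_mul_of_isHomogeneous (linForm_isHomogeneous l), ← hq, add_comm,
      homogeneousComponent_eq_self]
    exact (ω.isHomogeneous i).sub ((dotForm_isHomogeneous o ω.isHomogeneous).C_mul _)
  refine ⟨fun i => homogeneousComponent d (q i), fun i => homogeneousComponent_isHomogeneous _ _,
    ?_, ?_⟩
  · have h1 : linForm l * dotForm o (fun i => homogeneousComponent d (q i)) = 0 := by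
      have ho' := C_mul_C_add_eq_one ho
      simp only [dotForm, Fin.sum_univ_three] at hφ ⊢
      linear_combination (-C (o 0)) * hθ 0 - C (o 1) * hθ 1 - C (o 2) * hθ 2 - φ * ho' - hφ
    exact (mul_eq_zero.1 h1).resolve_left (linForm_ne_zero hl)
  · have hE := ω.euler
    have h2 : φ = -∑ k, X k * homogeneousComponent d (q k) := by
      refine mul_left_cancel₀ (linForm_ne_zero hl) ?_
      simp only [Fin.sum_univ_three] at hE ⊢
      have hX : linForm l = C (l 0) * X 0 + C (l 1) * X 1 + C (l 2) * X 2 := by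
        simp [linForm, Fin.sum_univ_three]
      linear_combination hE - X 0 * hθ 0 - X 1 * hθ 1 - X 2 * hθ 2 + φ * hX
    ext1 i
    rw [lineForm, ← hθ i, ← sub_eq_zero]
    rw [h2]; ring

theorem sum_X_mul_projHom {l o : Fin 3 → ℂ} {θ : Fin 3 → MvPolynomial (Fin 3) ℂ}
    (hθ : dotForm o θ = 0) :
    ∑ k, X k * projHom l o (θ k) = projHom l o (∑ k, X k * θ k) := by
  have h := congrArg (projHom l o) hθ
  have hX : ∀ k, projHom l o (X k) = X k - C (o k) * linForm l := fun k => by simp [projHom]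
  simp only [dotForm, map_mul, algHom_C, algebraMap_eq, map_zero, Fin.sum_univ_three, hX,
    map_add] at h ⊢
  linear_combination linForm l * h

/-- On the invariant line, a form `lineForm l θ` does not change when `θ` is replaced by its
composition with the projection onto the line. -/
theorem evalForm_lineForm_projHom {l o : Fin 3 → ℂ} {θ : Fin 3 → MvPolynomial (Fin 3) ℂ}
    {x : Fin 3 → ℂ} (hx : l ⬝ᵥ x = 0) (v : Fin 3 → ℂ) :
    evalForm (lineForm l fun i => projHom l o (θ i)) x v = evalForm (lineForm l θ) x v := by
  rw [evalForm_lineForm, evalForm_lineForm]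
  simp [evalForm, eval_projHom, hx]

theorem dotForm_lineForm {l s : Fin 3 → ℂ} (hs : l ⬝ᵥ s = 0)
    (θ : Fin 3 → MvPolynomial (Fin 3) ℂ) :
    dotForm s (lineForm l θ) = linForm l * dotForm s θ := by
  refine MvPolynomial.funext fun x => ?_
  rw [eval_dotForm_eq_evalForm, evalForm_lineForm, hs, zero_mul, sub_zero, map_mul, eval_linForm,
    eval_dotForm_eq_evalForm]

theorem projHom_dotForm (l o s : Fin 3 → ℂ) (θ : Fin 3 → MvPolynomial (Fin 3) ℂ) :
    dotForm s (fun i => projHom l o (θ i)) = projHom l o (dotForm s θ) := by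
  simp [dotForm, map_sum, map_mul, algHom_C]

theorem eval_pderiv_lineForm {l s : Fin 3 → ℂ} (hs : l ⬝ᵥ s = 0)
    (θ : Fin 3 → MvPolynomial (Fin 3) ℂ) (k i : Fin 3) :
    eval s (pderiv k (lineForm l θ i)) =
      l k * eval s (θ i) - l i * eval s (pderiv k (∑ k, X k * θ k)) := by
  rw [lineForm, map_sub, pderiv_mul, pderiv_C_mul, pderiv_linForm]
  simp [hs]

/-- At a point of the line, the derivatives of the two forms differ by a multiple of `l ⊗ l`. -/
theorem exists_eval_pderiv_lineForm_projHom {l o s : Fin 3 → ℂ} (hs : l ⬝ᵥ s = 0)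
    {θ : Fin 3 → MvPolynomial (Fin 3) ℂ} (hθ : dotForm o θ = 0) :
    ∃ κ : ℂ, ∀ k i, eval s (pderiv k (lineForm l (fun i => projHom l o (θ i)) i)) =
      eval s (pderiv k (lineForm l θ i)) + κ * l k * l i := by
  obtain ⟨e, he⟩ := linForm_dvd_sub_projHom l o (∑ k, X k * θ k)
  refine ⟨eval s e, fun k i => ?_⟩
  rw [eval_pderiv_lineForm hs, eval_pderiv_lineForm hs, sum_X_mul_projHom hθ]
  have h := congrArg (fun f => eval s (pderiv k f)) he
  simp only [map_sub, pderiv_mul, pderiv_linForm, map_add, map_mul, eval_C, eval_linForm, hs,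
    zero_mul, add_zero] at h
  rw [eval_projHom, hs, zero_smul, sub_zero]
  linear_combination l i * h

theorem pderiv_projHom (l o : Fin 3 → ℂ) (f : MvPolynomial (Fin 3) ℂ) (j : Fin 3) :
    pderiv j (projHom l o f) =
      projHom l o (pderiv j f) - C (l j) * projHom l o (∑ k, C (o k) * pderiv k f) := by
  induction f using MvPolynomial.induction_on with
  | C a => simp [projHom]
  | add p q hp hq =>
    simp only [map_add, hp, hq, mul_add, Finset.sum_add_distrib]
    ring
  | mul_X p i hp =>
    have hX : projHom l o (X i) = X i - C (o i) * linForm l := by simp [projHom]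
    have e : ∑ k, C (o k) * pderiv k (p * X i) =
        (∑ k, C (o k) * pderiv k p) * X i + p * C (o i) := by
      simp only [pderiv_mul, Fin.sum_univ_three, pderiv_X, Pi.single_apply]
      obtain rfl | rfl | rfl : i = 0 ∨ i = 1 ∨ i = 2 := by omega
      all_goals simp; ring
    have hC : projHom l o (C (o i)) = C (o i) := by simp [projHom]
    have hδ : projHom l o (pderiv j (X i)) = pderiv j (X i) := by
      rw [pderiv_X, Pi.single_apply]; split_ifs <;> simp
    rw [e, map_mul, pderiv_mul, hp, pderiv_mul, map_add, map_mul, map_mul, map_add, map_mul,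
      map_mul, hX, hC, hδ, map_sub, pderiv_C_mul, pderiv_linForm]
    ring

theorem lieDerivative_projHom {l : Fin 3 → ℂ} (o : Fin 3 → ℂ)
    {Z : Fin 3 → MvPolynomial (Fin 3) ℂ} (hZ : dotForm l Z = 0) (f : MvPolynomial (Fin 3) ℂ) :
    lieDerivative (fun i => projHom l o (Z i)) (projHom l o f) =
      projHom l o (lieDerivative Z f) := by
  have h := congrArg (projHom l o) hZ
  have hC : ∀ a : ℂ, projHom l o (C a) = C a := fun a => by simp [projHom]
  simp only [dotForm, map_mul, map_zero, Fin.sum_univ_three, map_add, hC] at h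
  simp only [lieDerivative, pderiv_projHom, map_mul, Fin.sum_univ_three, map_add, hC]
  linear_combination (-(C (o 0) * projHom l o (pderiv 0 f) + C (o 1) * projHom l o (pderiv 1 f) +
    C (o 2) * projHom l o (pderiv 2 f))) * h

/-- For a vector field tangent to the planes `l = const`, the inflection divisor contains the line
`l = 0`, and the residual divisor is a determinant not involving the radial field. -/
theorem inflectionPolynomial_eq_linForm_mul {l o : Fin 3 → ℂ} (ho : l ⬝ᵥ o = 1)
    {Z : Fin 3 → MvPolynomial (Fin 3) ℂ} (hZ : dotForm l Z = 0) :
    inflectionPolynomial Z =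
      linForm l * dotForm o (crossProduct Z fun i => lieDerivative Z (Z i)) := by
  have hW := congrArg (lieDerivative Z) hZ
  rw [lieDerivative_dotForm] at hW
  have ho' := C_mul_C_add_eq_one ho
  have h0 : lieDerivative Z 0 = 0 := by simp [lieDerivative]
  rw [h0] at hW
  rw [inflectionPolynomial_eq]
  simp only [dotForm, linForm, Fin.sum_univ_three, cross_apply, Matrix.cons_val] at hZ hW ⊢
  generalize lieDerivative Z (Z 0) = W0 at *
  generalize lieDerivative Z (Z 1) = W1 at *
  generalize lieDerivative Z (Z 2) = W2 at *
  -- Cramer's rule: `l(o) det(R, Z, W) = l(R) det(o, Z, W) + l(Z) det(R, o, W) + l(W) det(R, Z, o)`.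
  linear_combination
    (-(X 0 * (Z 1 * W2 - Z 2 * W1) + X 1 * (Z 2 * W0 - Z 0 * W2) + X 2 * (Z 0 * W1 - Z 1 * W0))) *
      ho' +
    (X 0 * (C (o 1) * W2 - C (o 2) * W1) + X 1 * (C (o 2) * W0 - C (o 0) * W2) +
      X 2 * (C (o 0) * W1 - C (o 1) * W0)) * hZ +
    (X 0 * (Z 1 * C (o 2) - Z 2 * C (o 1)) + X 1 * (Z 2 * C (o 0) - Z 0 * C (o 2)) +
      X 2 * (Z 0 * C (o 1) - Z 1 * C (o 0))) * hW

/-- The degenerate form has the same inflection divisor, with the components other than `l = 0`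
replaced by their cones with vertex `o` over their traces on `l = 0`. -/
theorem inflectionPolynomial_lineField_projHom {l o : Fin 3 → ℂ} (ho : l ⬝ᵥ o = 1)
    {θ : Fin 3 → MvPolynomial (Fin 3) ℂ} {q : MvPolynomial (Fin 3) ℂ}
    (hq : inflectionPolynomial (lineField l θ) = linForm l * q) :
    inflectionPolynomial (lineField l fun i => projHom l o (θ i)) =
      linForm l * projHom l o q := by
  have hl : l ≠ 0 := by rintro rfl; simp at ho
  have hC : ∀ a : ℂ, projHom l o (C a) = C a := fun a => by simp [projHom]
  have hcross : ∀ U V : Fin 3 → MvPolynomial (Fin 3) ℂ,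
      crossProduct (fun i => projHom l o (U i)) (fun i => projHom l o (V i)) =
        fun i => projHom l o (crossProduct U V i) := by
    intro U V
    ext1 i
    obtain rfl | rfl | rfl : i = 0 ∨ i = 1 ∨ i = 2 := by omega
    all_goals simp [cross_apply]
  have hF : lineField l (fun i => projHom l o (θ i)) =
      fun i => projHom l o (lineField l θ i) := by
    have := hcross (fun i => C (l i)) θ
    simp only [hC] at this
    exact this
  rw [inflectionPolynomial_eq_linForm_mul ho (dotForm_lineField l θ)] at hq
  rw [← mul_left_cancel₀ (linForm_ne_zero hl) hq,
    inflectionPolynomial_eq_linForm_mul ho (dotForm_lineField l _), hF]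
  simp only [lieDerivative_projHom o (dotForm_lineField l θ), hcross, projHom_dotForm]

/-! ### Coprimality, invariant lines and dilations -/

/-- A non-constant polynomial has a zero outside any given line of `ℂ³` through the origin. -/
theorem exists_zero_not_on_line {q : MvPolynomial (Fin 3) ℂ} (hq : Irreducible q)
    {l o : Fin 3 → ℂ} : ∃ x, eval x q = 0 ∧ x - (l ⬝ᵥ x) • o ≠ 0 := by
  by_contra! h
  have hprime : (Ideal.span {q}).IsPrime :=
    (Ideal.span_singleton_prime hq.ne_zero).2 hq.prime
  -- By the Nullstellensatz `q` divides the equations of the line, which span a plane of forms.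
  have hdvd : ∀ k, q ∣ linForm (Pi.single k 1 - o k • l) := fun k => by
    rw [← Ideal.mem_span_singleton, ← IsPrime.vanishingIdeal_zeroLocus (K := ℂ) (Ideal.span {q}),
      mem_vanishingIdeal_iff]
    intro x hx
    have hx0 : eval x q = 0 := by
      simpa using hx q (Ideal.mem_span_singleton_self q)
    have := congrFun (h x hx0) k
    simp only [Pi.sub_apply, Pi.smul_apply, smul_eq_mul, Pi.zero_apply] at this
    change eval x (linForm _) = 0
    rw [eval_linForm, sub_dotProduct, smul_dotProduct, single_one_dotProduct, smul_eq_mul,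
      ← this]
    ring
  have hw : ∃ w : Fin 3 → ℂ, ∀ k, ∃ c : ℂ, Pi.single k 1 - o k • l = c • w := by
    by_cases h0 : ∀ k, Pi.single k 1 - o k • l = 0
    · exact ⟨0, fun k => ⟨0, by rw [h0 k, smul_zero]⟩⟩
    push Not at h0
    obtain ⟨k, hk⟩ := h0
    refine ⟨Pi.single k 1 - o k • l, fun j => exists_smul_of_linForm_dvd hk ?_⟩
    exact (hq.associated_of_dvd (prime_linForm hk).irreducible (hdvd k)).symm.dvd.trans (hdvd j)
  obtain ⟨w, hw⟩ := hw
  obtain ⟨x, hx, hlw⟩ := (Matrix.exists_mulVec_eq_zero_iff (M := Matrix.of ![l, w, 0])).2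
    (Matrix.det_eq_zero_of_row_eq_zero 2 fun _ => rfl)
  have hl : l ⬝ᵥ x = 0 := congrFun hlw 0
  have hwx : w ⬝ᵥ x = 0 := congrFun hlw 1
  refine hx (funext fun k => ?_)
  obtain ⟨c, hc⟩ := hw k
  have := congrArg (· ⬝ᵥ x) hc
  simpa [sub_dotProduct, smul_dotProduct, hl, hwx] using this

/-- The degenerate form has coprime coefficients if `θ` has no zero on the invariant line. -/
theorem isUnit_of_dvd_lineForm_projHom {d : ℕ} (ω : FoliationForm d) {l o : Fin 3 → ℂ}
    (ho : l ⬝ᵥ o = 1) {θ : Fin 3 → MvPolynomial (Fin 3) ℂ} (hθ : dotForm o θ = 0)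
    (hω : ω.coeff = lineForm l θ)
    (hnd : ∀ s, s ≠ 0 → l ⬝ᵥ s = 0 → ∃ i, eval s (θ i) ≠ 0) {p : MvPolynomial (Fin 3) ℂ}
    (hp : ∀ i, p ∣ lineForm l (fun i => projHom l o (θ i)) i) : IsUnit p := by
  have hl : l ≠ 0 := by rintro rfl; simp at ho
  by_contra hu
  obtain ⟨q, hq, hqp⟩ : ∃ q, Irreducible q ∧
      ∀ i, q ∣ lineForm l (fun i => projHom l o (θ i)) i := by
    by_cases h0 : p = 0
    · refine ⟨linForm l, (prime_linForm hl).irreducible, fun i => ?_⟩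
      have := hp i
      rw [h0, zero_dvd_iff] at this
      rw [this]
      exact dvd_zero _
    · obtain ⟨q, hq, hqp⟩ := WfDvdMonoid.exists_irreducible_factor hu h0
      exact ⟨q, hq, fun i => hqp.trans (hp i)⟩
  set φ := ∑ k, X k * θ k with hφ
  have hq' : ∀ i, q ∣ linForm l * projHom l o (θ i) - C (l i) * projHom l o φ := fun i => by
    rw [hφ, ← sum_X_mul_projHom hθ]; exact hqp i
  have hqφ : q ∣ projHom l o φ := by
    have h1 : projHom l o φ = -∑ i, C (o i) *
        (linForm l * projHom l o (θ i) - C (l i) * projHom l o φ) := by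
      have h2 := congrArg (projHom l o) hθ
      simp only [dotForm, map_mul, algHom_C, algebraMap_eq, map_zero, Fin.sum_univ_three,
        map_add] at h2
      rw [Fin.sum_univ_three]
      linear_combination linForm l * h2 - projHom l o φ * C_mul_C_add_eq_one ho
    rw [h1]
    exact (dvd_neg.2 (Finset.dvd_sum fun i _ => Dvd.dvd.mul_left (hq' i) _))
  have hqθ : ∀ i, q ∣ linForm l * projHom l o (θ i) := fun i =>
    (dvd_sub_left (Dvd.dvd.mul_left hqφ _)).1 (hq' i)
  by_cases hql : q ∣ linForm l
  · have hlq := (hq.associated_of_dvd (prime_linForm hl).irreducible hql).symm.dvd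
    have h1 : linForm l ∣ projHom l o φ := hlq.trans hqφ
    rw [linForm_dvd_iff_projHom_eq_zero ho, projHom_projHom ho,
      ← linForm_dvd_iff_projHom_eq_zero ho] at h1
    refine (prime_linForm hl).not_isUnit (ω.noCommonFactor _ fun i => ?_)
    rw [hω]
    exact dvd_sub (dvd_mul_right _ _) (Dvd.dvd.mul_left h1 _)
  · obtain ⟨x, hx, hx0⟩ := exists_zero_not_on_line hq (l := l) (o := o)
    obtain ⟨i, hi⟩ := hnd _ hx0 (by simp [dotProduct_sub, ho])
    obtain ⟨e, he⟩ := (hq.prime.dvd_or_dvd (hqθ i)).resolve_left hql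
    refine hi ?_
    rw [← eval_projHom, he, map_mul, hx, zero_mul]

theorem exists_smul_of_crossProduct_eq_zero {n p : Fin 3 → ℂ} (hn : n ≠ 0)
    (h : crossProduct n p = 0) : ∃ c : ℂ, p = c • n := by
  obtain ⟨k, hk⟩ := Function.ne_iff.1 hn
  simp only [Pi.zero_apply] at hk
  have h0 := congrFun h 0
  have h1 := congrFun h 1
  have h2 := congrFun h 2
  simp [cross_apply] at h0 h1 h2
  refine ⟨p k / n k, funext fun j => ?_⟩
  rw [Pi.smul_apply, smul_eq_mul, div_mul_eq_mul_div, eq_div_iff hk]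
  obtain rfl | rfl | rfl : k = 0 ∨ k = 1 ∨ k = 2 := by omega
  all_goals
    obtain rfl | rfl | rfl : j = 0 ∨ j = 1 ∨ j = 2 := by omega
    all_goals grind

theorem evalForm_projHom {l o : Fin 3 → ℂ} {θ : Fin 3 → MvPolynomial (Fin 3) ℂ}
    (hθ : dotForm o θ = 0) (x v : Fin 3 → ℂ) :
    evalForm (fun i => projHom l o (θ i)) x v =
      evalForm θ (x - (l ⬝ᵥ x) • o) (v - (l ⬝ᵥ v) • o) := by
  have := congrArg (eval (x - (l ⬝ᵥ x) • o)) hθ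
  rw [eval_dotForm_eq_evalForm, map_zero] at this
  simp only [evalForm, dotProduct_sub, dotProduct_smul] at this ⊢
  rw [this]
  simp [eval_projHom]

/-- A line `m = 0` invariant by the form `lineForm l θ` gives the invariant line of the degenerate
form that joins its intersection with `l = 0` to the point `o`. -/
theorem FormInvariant.lineForm_projHom {d : ℕ} (hd : 1 ≤ d) {l o m : Fin 3 → ℂ}
    {θ : Fin 3 → MvPolynomial (Fin 3) ℂ} (hθd : ∀ i, (θ i).IsHomogeneous d) (ho : l ⬝ᵥ o = 1)
    (hθ : dotForm o θ = 0) (hml : ∀ c : ℂ, l ≠ c • m) (hlm : ∀ c : ℂ, m ≠ c • l) (hm : m ≠ 0)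
    (hinv : FormInvariant (lineForm l θ) m) :
    FormInvariant (lineForm l fun i => projHom l o (θ i)) (m - (m ⬝ᵥ o) • l) := by
  have hl : l ≠ 0 := by rintro rfl; simp at ho
  have hθo := evalForm_projHom (l := l) hθ
  -- The trace of the line `m = 0` on `l = 0` is a zero of the coefficient `θ(R)`.
  have h1 : ∀ x, l ⬝ᵥ x = 0 → m ⬝ᵥ x = 0 → evalForm θ x x = 0 := fun x hlx hmx => by
    have : ∃ y, m ⬝ᵥ y = 0 ∧ l ⬝ᵥ y ≠ 0 := by
      by_contra! hn
      obtain ⟨c, hc⟩ := exists_smul_of_linForm_dvd hm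
        (linForm_dvd_of_eval_eq_zero hm (f := linForm l) fun x hx => by
          rw [eval_linForm]; exact hn x hx)
      exact hml c hc
    obtain ⟨y, hmy, hly⟩ := this
    have h := hinv x y hmx hmy
    rw [evalForm_lineForm, hlx, zero_mul, zero_sub, neg_eq_zero] at h
    exact (mul_eq_zero.1 h).resolve_left hly
  have h2 : ∀ x v, l ⬝ᵥ x = 0 → m ⬝ᵥ x = 0 → l ⬝ᵥ v = 0 → m ⬝ᵥ v = 0 → evalForm θ x v = 0 := by
    intro x v hlx hmx hlv hmv
    by_cases hx : x = 0
    · have h0 : ∀ i, eval x (θ i) = 0 := fun i => by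
        have := (hθd i).coeff_eq_zero (d := 0) (by simp; omega)
        rw [hx]
        simpa [constantCoeff_eq] using this
      simp [evalForm, h0, dotProduct]
    · have hxv : crossProduct x v = 0 := by
        have hc : crossProduct l m ≠ 0 := fun h0 => by
          obtain ⟨c, hc⟩ := exists_smul_of_crossProduct_eq_zero hl h0
          exact hlm c hc
        have hpar : ∀ y, l ⬝ᵥ y = 0 → m ⬝ᵥ y = 0 → ∃ c : ℂ, y = c • crossProduct l m := by
          intro y hly hmy
          refine exists_smul_of_crossProduct_eq_zero hc ?_
          simp only [dotProduct, Fin.sum_univ_three] at hly hmy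
          ext i
          obtain rfl | rfl | rfl : i = 0 ∨ i = 1 ∨ i = 2 := by omega
          · simp [cross_apply]; linear_combination m 0 * hly - l 0 * hmy
          · simp [cross_apply]; linear_combination m 1 * hly - l 1 * hmy
          · simp [cross_apply]; linear_combination m 2 * hly - l 2 * hmy
        obtain ⟨a, rfl⟩ := hpar x hlx hmx
        obtain ⟨b, rfl⟩ := hpar v hlv hmv
        simp
      obtain ⟨c, rfl⟩ := exists_smul_of_crossProduct_eq_zero hx hxv
      have := h1 x hlx hmx
      simp only [evalForm, dotProduct_smul] at this ⊢
      rw [this, smul_zero]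
  intro p v hp hv
  have key : ∀ x : Fin 3 → ℂ, (m - (m ⬝ᵥ o) • l) ⬝ᵥ x = 0 →
      l ⬝ᵥ (x - (l ⬝ᵥ x) • o) = 0 ∧ m ⬝ᵥ (x - (l ⬝ᵥ x) • o) = 0 := fun x hx => by
    refine ⟨by simp [dotProduct_sub, ho], ?_⟩
    rw [← hx]
    simp [dotProduct_sub, sub_dotProduct, mul_comm]
  rw [evalForm_lineForm, hθo, hθo, h2 _ _ (key p hp).1 (key p hp).2 (key v hv).1 (key v hv).2,
    h1 _ (key p hp).1 (key p hp).2, mul_zero, mul_zero, sub_zero]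

/-- The linear map `x ↦ x + (ε - 1) l(x) o`, which multiplies `o` by `ε` and fixes the plane `l = 0`
pointwise (when `l ⬝ᵥ o = 1`). -/
def dilation (l o : Fin 3 → ℂ) (ε : ℂ) : Matrix (Fin 3) (Fin 3) ℂ :=
  1 + (ε - 1) • Matrix.vecMulVec o l

theorem dilation_mulVec (l o : Fin 3 → ℂ) (ε : ℂ) (x : Fin 3 → ℂ) :
    dilation l o ε *ᵥ x = x + ((ε - 1) * (l ⬝ᵥ x)) • o := by
  rw [dilation, Matrix.add_mulVec, Matrix.one_mulVec, Matrix.smul_mulVec, Matrix.vecMulVec_mulVec]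
  ext i
  simp
  ring

theorem dilation_mul {l o : Fin 3 → ℂ} (ho : l ⬝ᵥ o = 1) (ε δ : ℂ) :
    dilation l o ε * dilation l o δ = dilation l o (ε * δ) := by
  refine Matrix.ext_of_mulVec_single fun i => ?_
  rw [← Matrix.mulVec_mulVec, dilation_mulVec, dilation_mulVec, dilation_mulVec]
  ext j
  simp [dotProduct_add, ho]
  ring

theorem dilation_one (l o : Fin 3 → ℂ) : dilation l o 1 = 1 := by simp [dilation]

/-- The dilation of ratio `ε ≠ 0` as an element of the linear group. -/
noncomputable def dilationUnit {l o : Fin 3 → ℂ} (ho : l ⬝ᵥ o = 1) {ε : ℂ} (hε : ε ≠ 0) :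
    GL (Fin 3) ℂ where
  val := dilation l o ε
  inv := dilation l o ε⁻¹
  val_inv := by rw [dilation_mul ho, mul_inv_cancel₀ hε, dilation_one]
  inv_val := by rw [dilation_mul ho, inv_mul_cancel₀ hε, dilation_one]

theorem matHom_dilation_zero (l o : Fin 3 → ℂ) (f : MvPolynomial (Fin 3) ℂ) :
    matHom (dilation l o 0) f = projHom l o f :=
  MvPolynomial.funext fun x => by
    rw [eval_matHom, eval_projHom, dilation_mulVec]
    congr 2
    ext i
    simp; ring

theorem pullbackForm_dilation {l o : Fin 3 → ℂ} (ho : l ⬝ᵥ o = 1)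
    {θ : Fin 3 → MvPolynomial (Fin 3) ℂ} (hθ : dotForm o θ = 0) (ε : ℂ) :
    pullbackForm (dilation l o ε) (lineForm l θ) =
      fun i => C ε * lineForm l (fun i => matHom (dilation l o ε) (θ i)) i := by
  refine evalForm_ext fun x v => ?_
  have h : ∀ y, evalForm θ y o = 0 := fun y => by
    rw [← eval_dotForm_eq_evalForm, hθ, map_zero]
  have hl : ∀ y, l ⬝ᵥ (dilation l o ε *ᵥ y) = ε * (l ⬝ᵥ y) := fun y => by
    rw [dilation_mulVec, dotProduct_add, dotProduct_smul, ho, smul_eq_mul]; ring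
  have hv : ∀ y, evalForm θ (dilation l o ε *ᵥ x) (dilation l o ε *ᵥ y) =
      evalForm θ (dilation l o ε *ᵥ x) y := fun y => by
    have := h (dilation l o ε *ᵥ x)
    rw [dilation_mulVec l o ε y]
    simp only [evalForm, dotProduct_add, dotProduct_smul] at this ⊢
    rw [this, smul_zero, add_zero]
  have hs : evalForm (fun i => C ε * lineForm l (fun i => matHom (dilation l o ε) (θ i)) i) x v =
      ε * evalForm (lineForm l (fun i => matHom (dilation l o ε) (θ i))) x v := by
    simp only [evalForm, dotProduct, Fin.sum_univ_three, map_mul, eval_C]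
    ring
  rw [evalForm_pullbackForm, evalForm_lineForm, hl, hl, hv, hv, hs, evalForm_lineForm]
  simp only [evalForm, eval_matHom]
  ring

theorem continuous_coeff_mul {P Q : ℂ → MvPolynomial (Fin 3) ℂ}
    (hP : ∀ m, Continuous fun ε => coeff m (P ε)) (hQ : ∀ m, Continuous fun ε => coeff m (Q ε))
    (m : Fin 3 →₀ ℕ) : Continuous fun ε => coeff m (P ε * Q ε) := by
  simp only [coeff_mul]
  exact continuous_finsetSum _ fun p _ => (hP _).mul (hQ _)

theorem continuous_coeff_matHom_dilation (l o : Fin 3 → ℂ) (f : MvPolynomial (Fin 3) ℂ)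
    (m : Fin 3 →₀ ℕ) : Continuous fun ε => coeff m (matHom (dilation l o ε) f) := by
  induction f using MvPolynomial.induction_on generalizing m with
  | C a => simpa [matHom] using continuous_const
  | add p q hp hq =>
    simp only [map_add, coeff_add]
    exact (hp m).add (hq m)
  | mul_X p i hp =>
    simp only [map_mul]
    refine continuous_coeff_mul hp (fun m => ?_) m
    simp only [matHom, aeval_X, coeff_sum, coeff_C_mul, dilation, Matrix.add_apply,
      Matrix.smul_apply, smul_eq_mul]
    fun_prop

theorem continuous_coeff_lineForm_dilation (l o : Fin 3 → ℂ)
    (θ : Fin 3 → MvPolynomial (Fin 3) ℂ) (i : Fin 3) (m : Fin 3 →₀ ℕ) :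
    Continuous fun ε => coeff m (lineForm l (fun i => matHom (dilation l o ε) (θ i)) i) := by
  have hc : ∀ p : MvPolynomial (Fin 3) ℂ, ∀ m, Continuous fun _ : ℂ => coeff m p := fun p m =>
    continuous_const
  simp only [lineForm, coeff_sub, coeff_C_mul, coeff_sum]
  refine (continuous_coeff_mul (hc _) (continuous_coeff_matHom_dilation l o _) m).sub
    (continuous_const.mul (continuous_finsetSum _ fun k _ => ?_))
  exact continuous_coeff_mul (hc _) (continuous_coeff_matHom_dilation l o _) m

/-! ### Local invariants in linear frames -/

theorem MvPolynomial.IsHomogeneous.eval_smul {f : MvPolynomial (Fin 3) ℂ} {n : ℕ}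
    (hf : f.IsHomogeneous n) (t : ℂ) (x : Fin 3 → ℂ) : eval (t • x) f = t ^ n * eval x f := by
  rw [eval_eq, eval_eq, Finset.mul_sum]
  refine Finset.sum_congr rfl fun m hm => ?_
  have hdeg : ∑ i ∈ m.support, m i = n := (hf.degree_eq_sum_deg_support hm).symm
  simp only [Pi.smul_apply, smul_eq_mul, mul_pow, Finset.prod_mul_distrib,
    Finset.prod_pow_eq_pow_sum, hdeg]
  ring

theorem pderiv_matHom (g : Matrix (Fin 3) (Fin 3) ℂ) (f : MvPolynomial (Fin 3) ℂ) (k : Fin 3) :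
    pderiv k (matHom g f) = ∑ m, C (g m k) * matHom g (pderiv m f) := by
  induction f using MvPolynomial.induction_on with
  | C a => simp [matHom]
  | add p q hp hq => simp only [map_add, hp, hq, mul_add, Finset.sum_add_distrib]
  | mul_X p i hp =>
    have hX : pderiv k (matHom g (X i)) = C (g i k) := by
      simp [matHom, pderiv_X, Pi.single_apply]
    have hδ : ∀ m, matHom g (pderiv m (X i)) = if i = m then 1 else 0 := fun m => by
      rw [pderiv_X, Pi.single_apply]
      split_ifs <;> simp_all
    rw [map_mul, pderiv_mul, hp, hX]
    simp only [pderiv_mul, map_add, map_mul, hδ, Fin.sum_univ_three]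
    obtain rfl | rfl | rfl : i = 0 ∨ i = 1 ∨ i = 2 := by omega
    all_goals simp; ring

/-- The derivative at `s`, along `v`, of the contraction of `ω` with the constant vector `w`. -/
noncomputable def jacobian (ω : Fin 3 → MvPolynomial (Fin 3) ℂ) (s v w : Fin 3 → ℂ) : ℂ :=
  ∑ k, ∑ i, v k * w i * eval s (pderiv k (ω i))

theorem eval_pderiv_pullbackForm (g : Matrix (Fin 3) (Fin 3) ℂ)
    (ω : Fin 3 → MvPolynomial (Fin 3) ℂ) (x : Fin 3 → ℂ) (k j : Fin 3) :
    eval x (pderiv k (pullbackForm g ω j)) = jacobian ω (g *ᵥ x) (g.col k) (g.col j) := by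
  simp only [pullbackForm_apply, pderiv_C_mul, pderiv_matHom, jacobian, map_mul,
    eval_C, eval_matHom, Fin.sum_univ_three, map_add, Matrix.col_apply]
  ring

theorem jacobian_lineForm {l s : Fin 3 → ℂ} (hs : l ⬝ᵥ s = 0)
    (θ : Fin 3 → MvPolynomial (Fin 3) ℂ) (v w : Fin 3 → ℂ) :
    jacobian (lineForm l θ) s v w = (l ⬝ᵥ v) * evalForm θ s w -
      (l ⬝ᵥ w) * ∑ k, v k * eval s (pderiv k (∑ k, X k * θ k)) := by
  simp only [jacobian, eval_pderiv_lineForm hs, dotProduct, evalForm, Fin.sum_univ_three]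
  ring

theorem exists_jacobian_lineForm_projHom {l o s : Fin 3 → ℂ} (hs : l ⬝ᵥ s = 0)
    {θ : Fin 3 → MvPolynomial (Fin 3) ℂ} (hθ : dotForm o θ = 0) :
    ∃ κ : ℂ, ∀ v w, jacobian (lineForm l fun i => projHom l o (θ i)) s v w =
      jacobian (lineForm l θ) s v w + κ * (l ⬝ᵥ v) * (l ⬝ᵥ w) := by
  obtain ⟨κ, hκ⟩ := exists_eval_pderiv_lineForm_projHom hs hθ
  refine ⟨κ, fun v w => ?_⟩
  simp only [jacobian, hκ, dotProduct, Fin.sum_univ_three]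
  ring

theorem jacobian_C_mul (c : ℂ) (ω : Fin 3 → MvPolynomial (Fin 3) ℂ) (s v w : Fin 3 → ℂ) :
    jacobian (fun i => C c * ω i) s v w = c * jacobian ω s v w := by
  simp only [jacobian, pderiv_C_mul, map_mul, eval_C, Fin.sum_univ_three]
  ring

theorem jacobian_sub_smul (ω : Fin 3 → MvPolynomial (Fin 3) ℂ) (s v w : Fin 3 → ℂ) (a b : ℂ) :
    jacobian ω s (b • v - a • w) (b • v - a • w) = b ^ 2 * jacobian ω s v v -
      a * b * (jacobian ω s v w + jacobian ω s w v) + a ^ 2 * jacobian ω s w w := by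
  simp only [jacobian, Fin.sum_univ_three, Pi.sub_apply, Pi.smul_apply, smul_eq_mul]
  ring

/-- The Gram determinant of the derivative of `lineForm l θ` at a point of the line is the same for
the degenerate form: the two derivatives differ by a multiple of `l ⊗ l`, and they vanish on the
direction of the line. -/
theorem gram_lineForm_projHom {l o s : Fin 3 → ℂ} (hs : l ⬝ᵥ s = 0)
    {θ : Fin 3 → MvPolynomial (Fin 3) ℂ} (hθ : dotForm o θ = 0) (v w : Fin 3 → ℂ) :
    let J := jacobian (lineForm l θ) s
    let J' := jacobian (lineForm l fun i => projHom l o (θ i)) s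
    J' v v * J' w w - J' v w * J' w v = J v v * J w w - J v w * J w v := by
  intro J J'
  obtain ⟨κ, hκ⟩ := exists_jacobian_lineForm_projHom hs hθ
  have h0 : J ((l ⬝ᵥ w) • v - (l ⬝ᵥ v) • w) ((l ⬝ᵥ w) • v - (l ⬝ᵥ v) • w) = 0 := by
    have h : l ⬝ᵥ ((l ⬝ᵥ w) • v - (l ⬝ᵥ v) • w) = 0 := by
      rw [dotProduct_sub, dotProduct_smul, dotProduct_smul, smul_eq_mul, smul_eq_mul]; ring
    simp only [J]
    rw [jacobian_lineForm hs, h]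
    ring
  simp only [J] at h0
  rw [jacobian_sub_smul] at h0
  simp only [J, J', hκ]
  linear_combination κ * h0

theorem Foliation.linearPart_zero_apply {d : ℕ} (F : Foliation d) {s : Plane} {g : GL (Fin 3) ℂ}
    (hg : IsFrameAt s g) (j : Fin 2) : F.linearPart g 0 j =
      jacobian F.form.coeff s.rep (g.val.col j.castSucc) (g.val.col 1) := by
  rw [Foliation.linearPart_apply]
  change constantCoeff (pderiv j (dehom (pullbackForm g.val F.form.coeff 1))) = _
  have hg' : g.val *ᵥ ![0, 0, 1] = s.rep := hg
  rw [pderiv_dehom, constantCoeff_dehom, eval_pderiv_pullbackForm, hg']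

theorem Foliation.linearPart_one_apply {d : ℕ} (F : Foliation d) {s : Plane} {g : GL (Fin 3) ℂ}
    (hg : IsFrameAt s g) (j : Fin 2) : F.linearPart g 1 j =
      -jacobian F.form.coeff s.rep (g.val.col j.castSucc) (g.val.col 0) := by
  rw [Foliation.linearPart_apply]
  change constantCoeff (pderiv j (-dehom (pullbackForm g.val F.form.coeff 0))) = _
  have hg' : g.val *ᵥ ![0, 0, 1] = s.rep := hg
  rw [map_neg, map_neg, pderiv_dehom, constantCoeff_dehom, eval_pderiv_pullbackForm, hg']

theorem Foliation.det_linearPart {d : ℕ} (F : Foliation d) {s : Plane} {g : GL (Fin 3) ℂ}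
    (hg : IsFrameAt s g) : (F.linearPart g).det =
      jacobian F.form.coeff s.rep (g.val.col 0) (g.val.col 0) *
        jacobian F.form.coeff s.rep (g.val.col 1) (g.val.col 1) -
      jacobian F.form.coeff s.rep (g.val.col 0) (g.val.col 1) *
        jacobian F.form.coeff s.rep (g.val.col 1) (g.val.col 0) := by
  rw [Matrix.det_fin_two, F.linearPart_zero_apply hg, F.linearPart_zero_apply hg,
    F.linearPart_one_apply hg, F.linearPart_one_apply hg, Fin.castSucc_zero, Fin.castSucc_one]
  ring

theorem Foliation.constantCoeff_localField {d : ℕ} (F : Foliation d) {s : Plane}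
    (hs : s ∈ F.sing) {g : GL (Fin 3) ℂ} (hg : IsFrameAt s g) (i : Fin 2) :
    constantCoeff (F.localField g i) = 0 := by
  have hg' : g.val *ᵥ ![0, 0, 1] = s.rep := hg
  have h : ∀ j, constantCoeff (dehom (pullbackForm g.val F.form.coeff j)) = 0 := fun j => by
    rw [constantCoeff_dehom, pullbackForm_apply, map_sum]
    refine Finset.sum_eq_zero fun i _ => ?_
    rw [map_mul, eval_matHom, hg', hs i, mul_zero]
  obtain rfl | rfl : i = 0 ∨ i = 1 := by omega
  · exact h 1
  · change constantCoeff (-dehom _) = 0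
    rw [map_neg, neg_eq_zero]
    exact h 0

theorem isFrameAt_frameAt (s : Plane) : IsFrameAt s (frameAt s) :=
  Classical.epsilon_spec (exists_isFrameAt s)

theorem isAdaptedFrame_adaptedFrame {ℓ : Line} {s : Plane} (h : s ∈ ℓ.points) :
    IsAdaptedFrame ℓ s (adaptedFrame ℓ s) :=
  Classical.epsilon_spec (exists_isAdaptedFrame ℓ s h)

theorem mem_points_iff {ℓ : Line} {s : Plane} : s ∈ ℓ.points ↔ ℓ.rep ⬝ᵥ s.rep = 0 := by
  have := Projectivization.orthogonal_mk ℓ.rep_nonzero s.rep_nonzero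
  rw [ℓ.mk_rep, s.mk_rep] at this
  exact this

theorem mulVec_last (g : Matrix (Fin 3) (Fin 3) ℂ) : g *ᵥ ![0, 0, 1] = g.col 2 := by
  ext i
  simp [Matrix.mulVec, dotProduct, Fin.sum_univ_three]

theorem pullbackForm_two (g : Matrix (Fin 3) (Fin 3) ℂ) (ω : Fin 3 → MvPolynomial (Fin 3) ℂ) :
    pullbackForm g ω 2 = matHom g (dotForm (g *ᵥ ![0, 0, 1]) ω) := by
  rw [mulVec_last, pullbackForm_apply, dotForm, map_sum]
  simp [algHom_C]

theorem vecMul_two (g : Matrix (Fin 3) (Fin 3) ℂ) (l : Fin 3 → ℂ) :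
    (l ᵥ* g) 2 = l ⬝ᵥ (g *ᵥ ![0, 0, 1]) := by
  rw [mulVec_last]; rfl

theorem vecMul_injective (g : GL (Fin 3) ℂ) : Function.Injective fun l => l ᵥ* g.val :=
  Matrix.vecMul_injective_of_isUnit g.isUnit

theorem vecMul_ne_zero (g : GL (Fin 3) ℂ) {l : Fin 3 → ℂ} (hl : l ≠ 0) : l ᵥ* g.val ≠ 0 :=
  fun h => hl (vecMul_injective g (by simpa using h))

/-- At a singular point `p` of a foliation with `3 d` invariant lines, in a linear frame at `p`, the
contact with lines through `p` has the number of invariant lines through `p` as vanishing order, and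
the linear part of the foliation is invertible. -/
theorem vanishingOrder_and_gram_ne_zero_of_frame {d : ℕ} (hd : 1 ≤ d) (ω : FoliationForm d)
    {ι : Type*} [Fintype ι] (hι : Fintype.card ι = 3 * d)
    {l : ι → Fin 3 → ℂ} (hl0 : ∀ i, l i ≠ 0) (hl : Pairwise fun i j => ∀ c : ℂ, l j ≠ c • l i)
    (hinv : ∀ i, FormInvariant ω.coeff (l i)) {p : Fin 3 → ℂ} (hp : ∀ i, eval p (ω.coeff i) = 0)
    {g : GL (Fin 3) ℂ} (hg : g.val *ᵥ ![0, 0, 1] = p) :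
    vanishingOrder (dehom (matHom g.val (dotForm p ω.coeff))) =
        ((Finset.univ.filter fun i => l i ⬝ᵥ p = 0).card : ℕ) ∧
      jacobian ω.coeff p (g.val.col 0) (g.val.col 0) *
          jacobian ω.coeff p (g.val.col 1) (g.val.col 1) -
        jacobian ω.coeff p (g.val.col 0) (g.val.col 1) *
          jacobian ω.coeff p (g.val.col 1) (g.val.col 0) ≠ 0 := by
  obtain ⟨i₀⟩ : Nonempty ι := Fintype.card_pos_iff.1 (by omega)
  have hne : ∀ i, l i ᵥ* g.val ≠ 0 := fun i => vecMul_ne_zero g (hl0 i)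
  have hinv' : ∀ i, FormInvariant (ω.pullback g).coeff (l i ᵥ* g.val) := fun i =>
    (hinv i).pullback g.val
  obtain ⟨o, ho⟩ := exists_dotProduct_eq_one (hne i₀)
  obtain ⟨θ, hθd, -, hθ⟩ := (ω.pullback g).exists_eq_lineForm ho (hinv' i₀)
  have := vanishingOrder_and_nondegenerate_of_sing hd (ω.pullback g)
    (lineField_isHomogeneous _ hθd) (hθ.trans (lineForm_eq_crossProduct _ _)) hι hne
    (fun i j hij c hc => hl hij c (vecMul_injective g (by
      simpa [Matrix.smul_vecMul] using hc))) hinv' fun j => by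
        change eval _ (pullbackForm g.val ω.coeff j) = 0
        rw [pullbackForm_apply, map_sum]
        exact Finset.sum_eq_zero fun i _ => by rw [map_mul, eval_matHom, hg, hp, mul_zero]
  simp only [vecMul_two, hg] at this
  change vanishingOrder (dehom (pullbackForm g.val ω.coeff 2)) = _ ∧
    eval ![0, 0, 1] (pderiv 0 (pullbackForm g.val ω.coeff 0)) *
      eval ![0, 0, 1] (pderiv 1 (pullbackForm g.val ω.coeff 1)) -
    eval ![0, 0, 1] (pderiv 0 (pullbackForm g.val ω.coeff 1)) *
      eval ![0, 0, 1] (pderiv 1 (pullbackForm g.val ω.coeff 0)) ≠ 0 at this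
  rwa [pullbackForm_two, hg, eval_pderiv_pullbackForm, eval_pderiv_pullbackForm,
    eval_pderiv_pullbackForm, eval_pderiv_pullbackForm, hg] at this

/-- A product of linear forms vanishing at the centre of a frame and of a polynomial not vanishing
there has the number of these forms as vanishing order. -/
theorem vanishingOrder_prod_linForm_mul {g : GL (Fin 3) ℂ} {p : Fin 3 → ℂ}
    (hg : g.val *ᵥ ![0, 0, 1] = p) {ι : Type*} (s : Finset ι) {l : ι → Fin 3 → ℂ}
    (hl0 : ∀ i ∈ s, l i ≠ 0) (hl : ∀ i ∈ s, l i ⬝ᵥ p = 0) (e : MvPolynomial (Fin 3) ℂ) :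
    vanishingOrder (dehom (matHom g.val ((∏ i ∈ s, linForm (l i)) * e))) =
      (s.card : ℕ) + vanishingOrder (dehom (matHom g.val e)) := by
  rw [map_mul, map_mul, vanishingOrder_mul, map_prod, map_prod, vanishingOrder_prod]
  congr 1
  rw [Finset.sum_congr rfl (g := fun _ => (1 : ℕ∞)) fun i hi => ?_]
  · simp
  · rw [matHom_linForm, vanishingOrder_dehom_linForm (vecMul_ne_zero g (hl0 i hi)), vecMul_two, hg,
      if_pos (hl i hi)]

theorem vanishingOrder_dehom_matHom_eq_zero_iff {g : GL (Fin 3) ℂ} {p : Fin 3 → ℂ}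
    (hg : g.val *ᵥ ![0, 0, 1] = p) (e : MvPolynomial (Fin 3) ℂ) :
    vanishingOrder (dehom (matHom g.val e)) = 0 ↔ eval p e ≠ 0 := by
  have h : constantCoeff (dehom (matHom g.val e)) = eval p e := by
    rw [constantCoeff_dehom, eval_matHom, hg]
  rw [← h]
  refine ⟨fun h0 h1 => ?_, vanishingOrder_eq_zero⟩
  have := one_le_vanishingOrder_iff.2 h1
  rw [h0] at this
  simp at this

/-! ### Homogeneity, limits of orbits and convexity -/

theorem evalForm_C_mul (c : ℂ) (ω : Fin 3 → MvPolynomial (Fin 3) ℂ) (x v : Fin 3 → ℂ) :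
    evalForm (fun i => C c * ω i) x v = c * evalForm ω x v := by
  simp only [evalForm, dotProduct, Fin.sum_univ_three, map_mul, eval_C]
  ring

theorem exists_GL_vecMul_eq (ℓ : Line) : ∃ h : GL (Fin 3) ℂ, ℓ.rep ᵥ* h.val = ![0, 0, 1] := by
  obtain ⟨g, hg⟩ := exists_isFrameAt ℓ
  have hg' : g.val *ᵥ ![0, 0, 1] = ℓ.rep := hg
  have hdet : IsUnit (g.val.transpose).det := by
    rw [Matrix.det_transpose]
    exact (Matrix.isUnit_iff_isUnit_det _).1 g.isUnit
  refine ⟨(Matrix.GeneralLinearGroup.mk'' g.val.transpose hdet)⁻¹, ?_⟩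
  have h1 : g.val.transpose *
      ((Matrix.GeneralLinearGroup.mk'' g.val.transpose hdet)⁻¹).val = 1 :=
    (Matrix.GeneralLinearGroup.mk'' g.val.transpose hdet).mul_inv
  rw [← hg', ← Matrix.vecMul_transpose, Matrix.vecMul_vecMul, h1, Matrix.vecMul_one]

/-- In a frame adapted to the line `l = 0` and to the centre `o` of the projection, the degenerate
form is multiplied by a constant under homotheties. -/
theorem pullbackForm_homothety {d : ℕ} {l o : Fin 3 → ℂ} {h : GL (Fin 3) ℂ}
    (hl : l ᵥ* h.val = ![0, 0, 1]) (ho : h.val *ᵥ ![0, 0, 1] = o)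
    {θ : Fin 3 → MvPolynomial (Fin 3) ℂ} (hθd : ∀ i, (θ i).IsHomogeneous d)
    (hθ : dotForm o θ = 0) (t : ℂˣ) :
    pullbackForm (homothety t).val
        (pullbackForm h.val (lineForm l fun i => projHom l o (θ i))) =
      fun i => C ((t : ℂ) ^ (d + 1)) *
        pullbackForm h.val (lineForm l fun i => projHom l o (θ i)) i := by
  have hlx : ∀ x, l ⬝ᵥ (h.val *ᵥ x) = x 2 := fun x => by
    rw [Matrix.dotProduct_mulVec, hl]; simp [dotProduct, Fin.sum_univ_three]
  have hT : ∀ x, (homothety t).val *ᵥ x = (t : ℂ) • x + ((1 - (t : ℂ)) * x 2) • ![0, 0, 1] := by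
    intro x
    change Matrix.diagonal ![(t : ℂ), (t : ℂ), 1] *ᵥ x = _
    refine funext fun i : Fin 3 => ?_
    rw [Matrix.mulVec_diagonal]
    obtain rfl | rfl | rfl : i = 0 ∨ i = 1 ∨ i = 2 := by omega
    · simp
    · simp
    · simp
      ring
  have hT2 : ∀ x, ((homothety t).val *ᵥ x) 2 = x 2 := fun x => by rw [hT]; simp; ring
  have hproj : ∀ x, h.val *ᵥ ((homothety t).val *ᵥ x) - x 2 • o =
      (t : ℂ) • (h.val *ᵥ x - x 2 • o) := fun x => by
    rw [hT, Matrix.mulVec_add, Matrix.mulVec_smul, Matrix.mulVec_smul, ho]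
    module
  have hscale : ∀ x v, evalForm θ ((t : ℂ) • x) ((t : ℂ) • v) = t ^ (d + 1) * evalForm θ x v := by
    intro x v
    simp only [evalForm, (hθd _).eval_smul, dotProduct, Fin.sum_univ_three, Pi.smul_apply,
      smul_eq_mul]
    ring
  refine evalForm_ext fun x v => ?_
  rw [evalForm_C_mul]
  simp only [evalForm_pullbackForm, evalForm_lineForm, evalForm_projHom hθ, hlx, hT2, hproj,
    hscale]
  ring

theorem Foliation.isHomogeneous_of_lineForm_projHom {d : ℕ} {ℓ : Line} {o : Fin 3 → ℂ}
    {h : GL (Fin 3) ℂ} (hl : ℓ.rep ᵥ* h.val = ![0, 0, 1]) (ho : h.val *ᵥ ![0, 0, 1] = o)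
    {θ : Fin 3 → MvPolynomial (Fin 3) ℂ} (hθd : ∀ i, (θ i).IsHomogeneous d)
    (hθ : dotForm o θ = 0) (η : FoliationForm d)
    (hη : η.coeff = lineForm ℓ.rep fun i => projHom ℓ.rep o (θ i)) :
    η.toFoliation.IsHomogeneous := by
  refine ⟨h, (η.pullback h).toFoliation, ⟨η, η.pullback h, rfl, rfl, rfl⟩, fun t => ?_⟩
  refine ⟨η.pullback h, (η.pullback h).pullback (homothety t), rfl, ?_, rfl⟩
  refine FoliationForm.toFoliation_eq_of_eq_C_mul (c := (t : ℂ) ^ (d + 1))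
    (pow_ne_zero _ t.ne_zero) ?_
  change pullbackForm _ (pullbackForm _ η.coeff) = _
  rw [hη, pullbackForm_homothety hl ho hθd hθ t, ← hη]
  rfl

/-- Along the dilations `x ↦ x + (ε - 1) l(x) o`, the foliation tends to the one defined by the
degenerate form when `ε` tends to `0`. -/
theorem Foliation.mem_closure_orbit_of_lineForm_projHom {d : ℕ} (F : Foliation d)
    {l o : Fin 3 → ℂ} (ho : l ⬝ᵥ o = 1) {θ : Fin 3 → MvPolynomial (Fin 3) ℂ}
    (hθ : dotForm o θ = 0) (hF : F.form.coeff = lineForm l θ) (η : FoliationForm d)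
    (hη : η.coeff = lineForm l fun i => projHom l o (θ i)) :
    η.toFoliation ∈ closure F.orbit := by
  classical
  let path : ℂ → FoliationForm d := fun ε =>
    if hε : ε = 0 then η
    else (F.form.pullback (dilationUnit ho hε)).scale ε⁻¹ (inv_ne_zero hε)
  have hpath : ∀ ε i, (path ε).coeff i =
      lineForm l (fun i => matHom (dilation l o ε) (θ i)) i := by
    intro ε i
    by_cases hε : ε = 0
    · subst hε
      simp only [path, dif_pos, hη, matHom_dilation_zero]
    · simp only [path, dif_neg hε]
      change C ε⁻¹ * pullbackForm (dilation l o ε) F.form.coeff i = _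
      rw [hF, pullbackForm_dilation ho hθ, ← mul_assoc, ← C_mul, inv_mul_cancel₀ hε, C_1, one_mul]
  have hcont : Continuous path := by
    refine continuous_induced_rng.2 (continuous_pi fun i => continuous_pi fun m => ?_)
    simp only [Function.comp_def, hpath]
    exact continuous_coeff_lineForm_dilation l o θ i m
  have hmk : Continuous fun ε => (path ε).toFoliation :=
    (continuous_quotient_mk' (s := FoliationForm.setoid d)).comp hcont
  have h0 : path 0 = η := dif_pos rfl
  have htend := (hmk.tendsto 0).mono_left (nhdsWithin_le_nhds (s := {0}ᶜ))
  simp only [h0] at htend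
  refine mem_closure_of_tendsto htend (eventually_mem_nhdsWithin.mono fun ε hε => ?_)
  have hε' : ε ≠ 0 := hε
  refine ⟨dilationUnit ho hε', F.form, F.form.pullback (dilationUnit ho hε'),
    F.toFoliation_form.symm, ?_, rfl⟩
  simp only [path, dif_neg hε']
  exact (FoliationForm.toFoliation_eq_of_eq_C_mul (inv_ne_zero hε') rfl).symm

theorem lieDerivative_C_mul (c : ℂ) (Z : Fin 3 → MvPolynomial (Fin 3) ℂ)
    (f : MvPolynomial (Fin 3) ℂ) :
    lieDerivative (fun i => C c * Z i) (C c * f) = C (c ^ 2) * lieDerivative Z f := by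
  simp only [lieDerivative, pderiv_C_mul, Fin.sum_univ_three, C_pow]
  ring

theorem inflectionPolynomial_C_mul (c : ℂ) (Z : Fin 3 → MvPolynomial (Fin 3) ℂ) :
    inflectionPolynomial (fun i => C c * Z i) = C (c ^ 3) * inflectionPolynomial Z := by
  simp only [inflectionPolynomial_eq, lieDerivative_C_mul, C_pow]
  ring

theorem exists_linForm_eq_C_mul_form {w : Fin 3 → ℂ} (hw : w ≠ 0) :
    ∃ a : ℂ, a ≠ 0 ∧ linForm w = C a * Line.form (Projectivization.mk ℂ w hw) := by
  obtain ⟨a, ha⟩ := Projectivization.exists_smul_eq_mk_rep ℂ w hw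
  refine ⟨(a : ℂ)⁻¹, inv_ne_zero a.ne_zero, ?_⟩
  change _ = C _ * linForm (Projectivization.mk ℂ w hw).rep
  rw [← ha, Units.smul_def, linForm_smul, ← mul_assoc, ← C_mul, inv_mul_cancel₀ a.ne_zero, C_1,
    one_mul]

theorem FormInvariant.mk_rep {ω : Fin 3 → MvPolynomial (Fin 3) ℂ} {w : Fin 3 → ℂ}
    (h : FormInvariant ω w) (hw : w ≠ 0) :
    FormInvariant ω (Projectivization.mk ℂ w hw).rep := by
  obtain ⟨a, ha⟩ := Projectivization.exists_smul_eq_mk_rep ℂ w hw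
  intro p v hp hv
  rw [← ha, Units.smul_def, smul_dotProduct, smul_eq_mul] at hp hv
  exact h p v ((mul_eq_zero.1 hp).resolve_left a.ne_zero)
    ((mul_eq_zero.1 hv).resolve_left a.ne_zero)

/-- A foliation whose inflection divisor is a product of linear forms defining invariant lines is
convex. -/
theorem Foliation.isConvex_of_prod_linForm {d : ℕ} (η : FoliationForm d)
    {Z : Fin 3 → MvPolynomial (Fin 3) ℂ} (hZ : ∀ i, (Z i).IsHomogeneous d)
    (hη : η.coeff = crossProduct Z X) {ι : Type*} (s : Finset ι) {w : ι → Fin 3 → ℂ}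
    (hw : ∀ i, w i ≠ 0) (hinv : ∀ i ∈ s, FormInvariant η.coeff (w i)) {c : ℂ} (hc : c ≠ 0)
    (hI : inflectionPolynomial Z = C c * ∏ i ∈ s, linForm (w i)) :
    η.toFoliation.IsConvex := by
  obtain ⟨a, ha, hform⟩ := η.exists_form_toFoliation_eq
  choose b hb hbw using fun i => exists_linForm_eq_C_mul_form (hw i)
  refine ⟨fun i => C a * Z i, ⟨fun i => (hZ i).C_mul _, ?_⟩, a ^ 3 * c * ∏ i ∈ s, b i,
    s.val.map fun i => Projectivization.mk ℂ (w i) (hw i), ?_, ?_, ?_⟩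
  · ext1 i
    rw [hform, hη]
    obtain rfl | rfl | rfl : i = 0 ∨ i = 1 ∨ i = 2 := by omega
    all_goals simp only [cross_apply, Matrix.cons_val]; ring
  · exact mul_ne_zero (mul_ne_zero (pow_ne_zero _ ha) hc)
      (Finset.prod_ne_zero_iff.2 fun i _ => hb i)
  · intro ℓ hℓ
    obtain ⟨i, hi, rfl⟩ := Multiset.mem_map.1 hℓ
    rw [Foliation.isInvariantLine_iff, hform]
    intro p v hp hv
    rw [evalForm_C_mul, (hinv i hi).mk_rep (hw i) p v hp hv, mul_zero]
  · rw [inflectionPolynomial_C_mul, hI, Multiset.map_map]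
    have : (s.val.map (Line.form ∘ fun i => Projectivization.mk ℂ (w i) (hw i))).prod =
        ∏ i ∈ s, Line.form (Projectivization.mk ℂ (w i) (hw i)) := rfl
    rw [this, Finset.prod_congr rfl fun i _ => hbw i, Finset.prod_mul_distrib, C_mul, C_mul,
      map_prod]
    ring

/-! ### Reduced convex foliations -/

/-- When there are `3 d` invariant lines, `θ` does not vanish on the invariant line `l = 0`: a zero
would be a singular point with a linear part of rank at most one. -/
theorem exists_eval_ne_zero_of_reducedConvex {d : ℕ} (hd : 1 ≤ d) (ω : FoliationForm d)
    {ι : Type*} [Fintype ι] (hι : Fintype.card ι = 3 * d)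
    {m : ι → Fin 3 → ℂ} (hm0 : ∀ i, m i ≠ 0) (hm : Pairwise fun i j => ∀ c : ℂ, m j ≠ c • m i)
    (hinv : ∀ i, FormInvariant ω.coeff (m i)) {l : Fin 3 → ℂ}
    {θ : Fin 3 → MvPolynomial (Fin 3) ℂ} (hθd : ∀ i, (θ i).IsHomogeneous d)
    (hω : ω.coeff = lineForm l θ) {s : Fin 3 → ℂ} (hs0 : s ≠ 0) (hs : l ⬝ᵥ s = 0) :
    ∃ i, eval s (θ i) ≠ 0 := by
  by_contra! h
  obtain ⟨a, ha⟩ := Projectivization.exists_smul_eq_mk_rep ℂ s hs0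
  obtain ⟨g, hg⟩ := exists_isFrameAt (Projectivization.mk ℂ s hs0)
  set p := (Projectivization.mk ℂ s hs0).rep with hp
  have hlp : l ⬝ᵥ p = 0 := by rw [← ha, Units.smul_def, dotProduct_smul, hs, smul_zero]
  have hθp : ∀ i, eval p (θ i) = 0 := fun i => by
    rw [← ha, Units.smul_def, (hθd i).eval_smul, h i, mul_zero]
  have hθp' : ∀ v, evalForm θ p v = 0 := fun v => by simp [evalForm, hθp, dotProduct]
  have hωp : ∀ i, eval p (ω.coeff i) = 0 := fun i => by
    have : evalForm ω.coeff p (Pi.single i 1) = 0 := by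
      rw [hω, evalForm_lineForm, hθp', hθp', mul_zero, mul_zero, sub_zero]
    simpa [evalForm] using this
  refine (vanishingOrder_and_gram_ne_zero_of_frame hd ω hι hm0 hm hinv hωp hg).2 ?_
  simp only [hω, jacobian_lineForm hlp, hθp', mul_zero, zero_sub]
  ring

/-- At a singular point `p` of the line `l = 0`, the contacts of the foliation and of the degenerate
foliation with lines through `p` have the same vanishing order. The polar of the foliation at `p` is
the product of the invariant lines through `p` and of a polynomial not vanishing at `p`; composing
the factors other than `l` with the projection preserves this property. -/
theorem vanishingOrder_polar_projHom {d : ℕ} (hd : 1 ≤ d) (ω : FoliationForm d)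
    {ι : Type*} [Fintype ι] (hι : Fintype.card ι = 3 * d)
    {m : ι → Fin 3 → ℂ} (hm0 : ∀ i, m i ≠ 0) (hm : Pairwise fun i j => ∀ c : ℂ, m j ≠ c • m i)
    (hinv : ∀ i, FormInvariant ω.coeff (m i)) (i₀ : ι) {o : Fin 3 → ℂ}
    {θ : Fin 3 → MvPolynomial (Fin 3) ℂ}
    (hω : ω.coeff = lineForm (m i₀) θ) {p : Fin 3 → ℂ} (hlp : m i₀ ⬝ᵥ p = 0)
    (hp : ∀ i, eval p (ω.coeff i) = 0) {g : GL (Fin 3) ℂ} (hg : g.val *ᵥ ![0, 0, 1] = p) :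
    ∃ n : ℕ, vanishingOrder (dehom (matHom g.val (dotForm p ω.coeff))) = (n + 1 : ℕ) ∧
      vanishingOrder (dehom (matHom g.val (dotForm p
        (lineForm (m i₀) fun i => projHom (m i₀) o (θ i))))) = (n + 1 : ℕ) := by
  classical
  obtain ⟨hord, -⟩ := vanishingOrder_and_gram_ne_zero_of_frame hd ω hι hm0 hm hinv hp hg
  set S := Finset.univ.filter fun i => m i ⬝ᵥ p = 0 with hS
  have hSp : ∀ i ∈ S, m i ⬝ᵥ p = 0 := fun i hi => (Finset.mem_filter.1 hi).2
  have hi₀ : i₀ ∈ S := Finset.mem_filter.2 ⟨Finset.mem_univ _, hlp⟩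
  obtain ⟨e, he⟩ := prod_linForm_dvd_dotForm (p := p) (s := S) hm0 hm hinv hSp
  have hcard : S.card = (S.erase i₀).card + 1 := (Finset.card_erase_add_one hi₀).symm
  have hep : eval p e ≠ 0 := by
    rw [he, vanishingOrder_prod_linForm_mul hg S (fun i _ => hm0 i) hSp] at hord
    rw [← vanishingOrder_dehom_matHom_eq_zero_iff hg]
    exact ENat.add_right_injective_of_ne_top (ENat.natCast_ne_top _) (hord.trans (add_zero _).symm)
  refine ⟨(S.erase i₀).card, by rw [hord, hcard], ?_⟩
  have hθ : dotForm p θ = (∏ i ∈ S.erase i₀, linForm (m i)) * e := by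
    refine mul_left_cancel₀ (linForm_ne_zero (hm0 i₀)) ?_
    rw [← dotForm_lineForm hlp, ← hω, he, ← mul_assoc,
      Finset.mul_prod_erase S (fun i => linForm (m i)) hi₀]
  have hw : ∀ i ∈ S.erase i₀, m i - (m i ⬝ᵥ o) • m i₀ ≠ 0 := fun i hi h =>
    hm (Finset.ne_of_mem_erase hi).symm _ (sub_eq_zero.1 h)
  have h1 := vanishingOrder_prod_linForm_mul hg ({i₀} : Finset ι) (l := m)
    (e := projHom (m i₀) o (dotForm p θ)) (fun i _ => hm0 i) fun i hi => by
      rw [Finset.mem_singleton.1 hi, hlp]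
  have h2 := vanishingOrder_prod_linForm_mul hg (S.erase i₀)
    (l := fun i => m i - (m i ⬝ᵥ o) • m i₀) hw (fun i hi => by
      rw [sub_dotProduct, smul_dotProduct, hSp i (Finset.mem_of_mem_erase hi), hlp]; simp)
    (projHom (m i₀) o e)
  rw [Finset.prod_singleton, Finset.card_singleton] at h1
  rw [dotForm_lineForm hlp, projHom_dotForm, h1, hθ, map_mul, map_prod]
  simp only [projHom_linForm]
  rw [h2, (vanishingOrder_dehom_matHom_eq_zero_iff hg _).2]
  · push_cast; ring
  · rwa [eval_projHom, hlp, zero_smul, sub_zero]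

theorem mainTheorem3 (d : ℕ) (hd : 1 ≤ d) (F : Foliation d) (hF : F.IsReducedConvex)
    (ℓ : Line) (hℓ : F.IsInvariantLine ℓ) :
    ∃ H : Foliation d, H.IsConvex ∧ H.IsHomogeneous ∧
      H ∈ closure F.orbit ∧
      H.IsInvariantLine ℓ ∧
      H.sing ∩ ℓ.points = F.sing ∩ ℓ.points ∧
      (∀ s ∈ H.sing ∩ ℓ.points, H.milnor s = 1) ∧
      (∀ s ∈ H.sing ∩ ℓ.points, H.tau s = F.tau s) ∧
      (∀ s ∈ H.sing ∩ ℓ.points,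
        F.milnor s = 1 ∧ H.camachoSad ℓ s = F.camachoSad ℓ s) := by
  classical
  have hF' : {ℓ | F.IsInvariantLine ℓ}.ncard = 3 * d := hF
  have hfin : {ℓ | F.IsInvariantLine ℓ}.Finite := Set.finite_of_ncard_ne_zero (by omega)
  have : Fintype {ℓ // F.IsInvariantLine ℓ} := hfin.fintype
  have hι : Fintype.card {ℓ // F.IsInvariantLine ℓ} = 3 * d := by
    rw [← hF', ← Nat.card_eq_fintype_card]
    rfl
  let m : {ℓ // F.IsInvariantLine ℓ} → Fin 3 → ℂ := fun i => i.1.rep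
  let i₀ : {ℓ // F.IsInvariantLine ℓ} := ⟨ℓ, hℓ⟩
  have hm0 : ∀ i, m i ≠ 0 := fun i => i.1.rep_nonzero
  have hm : Pairwise fun i j => ∀ c : ℂ, m j ≠ c • m i := fun i j hij c hc => by
    refine hij (Subtype.ext ?_)
    rw [← i.1.mk_rep, ← j.1.mk_rep]
    exact ((Projectivization.mk_eq_mk_iff' ℂ _ _ j.1.rep_nonzero i.1.rep_nonzero).2
      ⟨c, hc.symm⟩).symm
  have hinv : ∀ i, FormInvariant F.form.coeff (m i) := fun i => i.2
  obtain ⟨h, hh⟩ := exists_GL_vecMul_eq ℓ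
  obtain ⟨o, ho⟩ : ∃ o, h.val *ᵥ ![0, 0, 1] = o := ⟨_, rfl⟩
  have hlo : ℓ.rep ⬝ᵥ o = 1 := by
    rw [← ho, Matrix.dotProduct_mulVec, hh]
    simp [dotProduct, Fin.sum_univ_three]
  obtain ⟨θ, hθd, hθ, hω⟩ := F.form.exists_eq_lineForm hlo hℓ
  have hnd : ∀ s, s ≠ 0 → ℓ.rep ⬝ᵥ s = 0 → ∃ i, eval s (θ i) ≠ 0 := fun s hs0 hs =>
    exists_eval_ne_zero_of_reducedConvex hd F.form hι hm0 hm hinv hθd hω hs0 hs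
  have hθ'd : ∀ i, (projHom ℓ.rep o (θ i)).IsHomogeneous d := fun i =>
    projHom_isHomogeneous _ _ (hθd i)
  let η : FoliationForm d :=
    { coeff := lineForm ℓ.rep fun i => projHom ℓ.rep o (θ i)
      isHomogeneous := lineForm_isHomogeneous _ hθ'd
      noCommonFactor := fun p hp => isUnit_of_dvd_lineForm_projHom F.form hlo hθ hω hnd hp
      euler := euler_lineForm _ _ }
  have hη : η.coeff = lineForm ℓ.rep fun i => projHom ℓ.rep o (θ i) := rfl
  obtain ⟨c, hc, hform⟩ := η.exists_form_toFoliation_eq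
  rw [hη] at hform
  -- The form of `H` is only determined up to the nonzero factor `c`.
  have hline : ∀ p v, ℓ.rep ⬝ᵥ p = 0 →
      evalForm η.toFoliation.form.coeff p v = c * evalForm F.form.coeff p v := by
    intro p v hp
    rw [hform, evalForm_C_mul, evalForm_lineForm_projHom hp, hω]
  have hsing : η.toFoliation.sing ∩ ℓ.points = F.sing ∩ ℓ.points := by
    ext s
    refine and_congr_left fun hs => forall_congr' fun i => ?_
    have := hline s.rep (Pi.single i 1) (mem_points_iff.1 hs)
    simp only [evalForm, dotProduct_single_one] at this
    rw [this, mul_eq_zero, or_iff_right hc]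
  have hjac : ∀ s v w, jacobian η.toFoliation.form.coeff s v w =
      c * jacobian η.coeff s v w := fun s v w => by rw [hform, jacobian_C_mul, hη]
  have hgram : ∀ s ∈ F.sing ∩ ℓ.points, (F.linearPart (frameAt s)).det ≠ 0 := fun s hs => by
    rw [F.det_linearPart (isFrameAt_frameAt s)]
    exact (vanishingOrder_and_gram_ne_zero_of_frame hd F.form hι hm0 hm hinv hs.1
      (isFrameAt_frameAt s)).2
  refine ⟨η.toFoliation, ?_, ?_, ?_, ?_, hsing, fun s hs => ?_, fun s hs => ?_,
    fun s hs => ⟨?_, ?_⟩⟩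
  · obtain ⟨a, ha, hI⟩ := inflectionPolynomial_eq_prod hd F.form
      (lineField_isHomogeneous ℓ.rep hθd) (hω.trans (lineForm_eq_crossProduct _ _)) hι hm0 hm hinv
    rw [← Finset.mul_prod_erase _ _ (Finset.mem_univ i₀), mul_left_comm] at hI
    have hI' := inflectionPolynomial_lineField_projHom hlo hI
    have hlines : ∀ i ∈ Finset.univ.erase i₀, m i - (m i ⬝ᵥ o) • ℓ.rep ≠ 0 := fun i hi h0 =>
      hm (Finset.ne_of_mem_erase hi).symm _ (sub_eq_zero.1 h0)
    -- The projection along `o` kills the equation of `ℓ` itself, which is restored here.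
    let w : {ℓ // F.IsInvariantLine ℓ} → Fin 3 → ℂ := fun i =>
      if i = i₀ then ℓ.rep else m i - (m i ⬝ᵥ o) • ℓ.rep
    refine Foliation.isConvex_of_prod_linForm η (lineField_isHomogeneous ℓ.rep hθ'd)
      (lineForm_eq_crossProduct _ _) Finset.univ (w := w) (fun i => ?_) (fun i _ => ?_) ha ?_
    · by_cases hi : i = i₀
      · simpa only [w, if_pos hi] using ℓ.rep_nonzero
      · simpa only [w, if_neg hi] using hlines i (Finset.mem_erase.2 ⟨hi, Finset.mem_univ _⟩)
    · by_cases hi : i = i₀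
      · simp only [w, if_pos hi]
        intro p v hp hv
        rw [hη, evalForm_lineForm, hp, hv, zero_mul, zero_mul, sub_zero]
      · simp only [w, if_neg hi]
        exact FormInvariant.lineForm_projHom hd hθd hlo hθ (hm hi) (hm (Ne.symm hi)) (hm0 i)
          (hω ▸ hinv i)
    · rw [hI', ← Finset.mul_prod_erase _ _ (Finset.mem_univ i₀), map_mul, map_prod, algHom_C,
        algebraMap_eq, mul_left_comm]
      have h1 : w i₀ = ℓ.rep := if_pos rfl
      rw [h1]
      congr 2
      refine Finset.prod_congr rfl fun i hi => ?_
      rw [projHom_linForm]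
      simp only [w, if_neg (Finset.ne_of_mem_erase hi)]
  · exact Foliation.isHomogeneous_of_lineForm_projHom hh ho hθd hθ η hη
  · exact F.mem_closure_orbit_of_lineForm_projHom hlo hθ hω η hη
  · intro p v hp hv
    change evalForm η.toFoliation.form.coeff p v = 0
    rw [hline p v hp]
    exact mul_eq_zero_of_right _ (hℓ p v hp hv)
  · refine Foliation.milnor_eq_one _ s
      (Foliation.constantCoeff_localField _ hs.1 (isFrameAt_frameAt s)) ?_
    rw [hsing] at hs
    have h1 := hgram s hs
    rw [F.det_linearPart (isFrameAt_frameAt s), hω,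
      ← gram_lineForm_projHom (mem_points_iff.1 hs.2) hθ] at h1
    rw [Foliation.det_linearPart _ (isFrameAt_frameAt s)]
    simp only [hjac, hη]
    refine fun h0 => h1 (mul_left_cancel₀ (pow_ne_zero 2 hc) ?_)
    rw [mul_zero, ← h0]
    ring
  · rw [hsing] at hs
    obtain ⟨n, h1, h2⟩ := vanishingOrder_polar_projHom hd F.form hι hm0 hm hinv i₀ (o := o) hω
      (mem_points_iff.1 hs.2) hs.1 (isFrameAt_frameAt s)
    have hframe : (frameAt s).val *ᵥ ![0, 0, 1] = s.rep := isFrameAt_frameAt s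
    rw [F.tau_eq s (n := n) (by rw [pullbackForm_two, hframe, h1])]
    refine Foliation.tau_eq _ s ?_
    have h3 : dotForm s.rep η.toFoliation.form.coeff = C c * dotForm s.rep η.coeff := by
      rw [hform, hη]
      simp only [dotForm, Fin.sum_univ_three]
      ring
    rw [pullbackForm_two, hframe, h3, map_mul, map_mul, vanishingOrder_mul,
      (vanishingOrder_dehom_matHom_eq_zero_iff hframe (C c)).2 (by simpa using hc), zero_add]
    exact h2
  · rw [hsing] at hs
    exact F.milnor_eq_one s (F.constantCoeff_localField hs.1 (isFrameAt_frameAt s)) (hgram s hs)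
  · obtain ⟨hg, hgl⟩ := isAdaptedFrame_adaptedFrame hs.2
    have hcol : ℓ.rep ⬝ᵥ (adaptedFrame ℓ s).val.col 0 = 0 := by
      rw [← hgl]
      congr 1
      ext i
      simp [Matrix.mulVec, dotProduct, Fin.sum_univ_three]
    obtain ⟨κ, hκ⟩ := exists_jacobian_lineForm_projHom (mem_points_iff.1 hs.2) hθ
    rw [Foliation.camachoSad, Foliation.camachoSad, Foliation.linearPart_one_apply _ hg,
      Foliation.linearPart_zero_apply _ hg, Foliation.linearPart_one_apply _ hg,
      Foliation.linearPart_zero_apply _ hg, hjac, hjac, hη, hκ, hκ, ← hω]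
    simp only [Fin.castSucc_zero, Fin.castSucc_one, hcol, mul_zero, zero_mul, add_zero]
    rw [← mul_neg, mul_div_mul_left _ _ hc]
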